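/- **Conventions.** For a graph $G$ on $[n]=\{1,\dots,n\}$ let $P_G$ be the partial order on $[n]$ obtained as the reflexive-transitive closure of the relation "$i<j$ and $ij\in E(G)$". A realiser of a finite poset $P$ is a set of total orders on its elements, each extending $P$, such that for every pair $x,y$ incomparable in $P$ some order in the set puts $x$ below $y$ and some order in the set puts $y$ below $x$; $\dim P$ is the minimum size of a realiser. $\mathcal G(n,p)$ is the random graph on $[n]$ in which each edge is present independently with probability $p$; a.a.s. means with probability tending to $1$ as $n\to\infty$. For $c>0$ let $\alpha_c$ be the unique positive solution $x$ of $\frac{e^2}{x^2}e^{-cx}=1$, and let $Li_2(z)=-\int_0^z y^{-1}\log(1-y)\,dy$ for $0\le z\le 1$. **Theorem.** (a) Let $c>0$ be fixed and $p=c/n$. Suppose that $\xi,\beta$ are fixed positive real numbers such that $\xi+\alpha_c<1/2$ and $\sup_{0\le t\le\alpha_c}f(c,\xi,\beta,t)<0$, where $$\begin{aligned}f(c,\xi,\beta,t)={}&\beta\log(e\xi/\beta)-c\beta\left(\tfrac12-\xi-t\right)+\frac1c\left(Li_2(1)-Li_2(e^{-ct})\right)\\&+\frac1c\left(Li_2(e^{-c\beta-ct})-Li_2(e^{-c\beta})+Li_2(e^{-c(1/2-\xi-t)-ct})-Li_2(e^{-c(1/2-\xi-t)})\right).\end{aligned}$$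 Then a.a.s. $\dim P_{\mathcal G(n,p)}\ge \frac{\xi}{2\beta}$. (b) There are constants $\gamma(c)>0$ $(c>0)$ with $\lim_{c\to\infty}\gamma(c)=\frac16$ such that, for every fixed $c>0$ and $p=c/n$, a.a.s. $\dim P_{\mathcal G(n,p)}\ge e^{\gamma(c)c}$. -/

import Mathlib

open Filter Topology

namespace RandomGraphOrder

/-- `R` is a realiser of the partial order `P`: a set of (strict) total orders on `V`, each of them
extending `P`, such that every incomparable pair occurs in both directions. -/
structure IsRealiser {V : Type*} (P : PartialOrder V) (R : Set (V → V → Prop)) : Prop where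
  isStrictTotalOrder : ∀ L ∈ R, IsStrictTotalOrder V L
  extends_lt : ∀ i j : V, P.lt i j → ∀ L ∈ R, L i j
  reverses : ∀ i j : V, ¬ P.le i j → ¬ P.le j i → (∃ L ∈ R, L i j) ∧ ∃ L ∈ R, L j i

/-- The dimension of a finite poset: the least size of a realiser. -/
noncomputable def posetDim {V : Type*} [Finite V] (P : PartialOrder V) : ℕ :=
  sInf (Set.ncard '' {R : Set (V → V → Prop) | IsRealiser P R})

/-- The partial order generated by a graph `G` on a linearly ordered vertex set: the reflexive and
transitive closure of the relation "`i < j` and `ij` is an edge of `G`". -/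
@[reducible]
def graphOrder {V : Type*} [LinearOrder V] (G : SimpleGraph V) : PartialOrder V where
  le := Relation.ReflTransGen fun i j => i < j ∧ G.Adj i j
  lt a b := Relation.ReflTransGen (fun i j => i < j ∧ G.Adj i j) a b ∧
    ¬ Relation.ReflTransGen (fun i j => i < j ∧ G.Adj i j) b a
  lt_iff_le_not_ge _ _ := Iff.rfl
  le_refl _ := Relation.ReflTransGen.refl
  le_trans _ _ _ := Relation.ReflTransGen.trans
  le_antisymm := by
    have h : ∀ a b : V, Relation.ReflTransGen (fun i j => i < j ∧ G.Adj i j) a b → a ≤ b := by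
      intro a b hab
      induction hab with
      | refl => exact le_rfl
      | tail _ hbc ih => exact ih.trans hbc.1.le
    exact fun a b hab hba => le_antisymm (h a b hab) (h b a hba)

/-- The edge probability `c / n`, truncated to `[0, 1]` (which only matters for `n < c`). -/
noncomputable def edgeProb (c : ℝ) (n : ℕ) : unitInterval :=
  Set.projIcc (0 : ℝ) 1 zero_le_one (c / n)

/-- The (real) dilogarithm `Li₂(z) = -∫₀ᶻ y⁻¹ log (1 - y) dy`; it is used only for
`0 ≤ z ≤ 1`, where the integrand is integrable. -/
noncomputable def Li2 (z : ℝ) : ℝ :=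
  -∫ y in (0 : ℝ)..z, y⁻¹ * Real.log (1 - y)

theorem existsUnique_alpha {c : ℝ} (hc : 0 < c) :
    ∃! x : ℝ, 0 < x ∧ Real.exp 2 / x ^ 2 * Real.exp (-(c * x)) = 1 := by
  have key : ∀ x : ℝ, 0 < x → (Real.exp 2 / x ^ 2 * Real.exp (-(c * x)) = 1 ↔
      x ^ 2 * Real.exp (c * x) = Real.exp 2) := by
    intro x hx
    rw [Real.exp_neg]
    have := Real.exp_pos (c * x)
    field_simp
    exact eq_comm
  have mono : ∀ x y : ℝ, 0 < x → x < y →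
      x ^ 2 * Real.exp (c * x) < y ^ 2 * Real.exp (c * y) := by
    intro x y hx hxy
    have h1 : x ^ 2 < y ^ 2 := by gcongr
    have h2 : Real.exp (c * x) < Real.exp (c * y) := by gcongr
    exact mul_lt_mul'' h1 h2 (by positivity) (by positivity)
  have hcont : Continuous fun x : ℝ => x ^ 2 * Real.exp (c * x) := by fun_prop
  have hmem : Real.exp 2 ∈ Set.Icc ((0 : ℝ) ^ 2 * Real.exp (c * 0))
      (Real.exp 1 ^ 2 * Real.exp (c * Real.exp 1)) := by
    constructor
    · simpa using (Real.exp_pos 2).le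
    · have h1 : Real.exp 1 ^ 2 = Real.exp 2 := by
        rw [← Real.exp_nat_mul]; norm_num
      rw [h1]
      have h2 : 1 ≤ Real.exp (c * Real.exp 1) := Real.one_le_exp (by positivity)
      exact le_mul_of_one_le_right (Real.exp_pos 2).le h2
  obtain ⟨x, hx, hfx⟩ := intermediate_value_Icc (Real.exp_pos 1).le hcont.continuousOn hmem
  have hx0 : 0 < x := by
    rcases hx.1.lt_or_eq with h | h
    · exact h
    · subst h
      simp at hfx
      exact absurd hfx.symm (Real.exp_ne_zero 2)
  refine ⟨x, ⟨hx0, (key x hx0).2 hfx⟩, ?_⟩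
  rintro y ⟨hy0, hy⟩
  have hfy := (key y hy0).1 hy
  simp only at hfx
  rcases lt_trichotomy y x with h | h | h
  · have := mono y x hy0 h
    linarith
  · exact h
  · have := mono x y hx0 h
    linarith

open Classical in
/-- `α_c`, for `c > 0`: the unique positive solution `x` of `(e² / x²) e^(-c x) = 1`. -/
noncomputable def alpha (c : ℝ) : ℝ :=
  if hc : 0 < c then (existsUnique_alpha hc).choose else 0

theorem alpha_spec {c : ℝ} (hc : 0 < c) :
    0 < alpha c ∧ Real.exp 2 / alpha c ^ 2 * Real.exp (-(c * alpha c)) = 1 := by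
  rw [alpha, dif_pos hc]
  exact (existsUnique_alpha hc).choose_spec.1

/-- The function `f(c, ξ, β, t)`. -/
noncomputable def f (c ξ β t : ℝ) : ℝ :=
  β * Real.log (Real.exp 1 * ξ / β) - c * β * (1 / 2 - ξ - t)
    + 1 / c * (Li2 1 - Li2 (Real.exp (-(c * t))))
    + 1 / c * (Li2 (Real.exp (-(c * β) - c * t)) - Li2 (Real.exp (-(c * β)))
        + Li2 (Real.exp (-(c * (1 / 2 - ξ - t)) - c * t))
        - Li2 (Real.exp (-(c * (1 / 2 - ξ - t)))))

end RandomGraphOrder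

namespace RandomGraphOrder

/-! Let `X` and `Y` be the lowest and the highest `k ≈ ξn` vertices, `b ≈ βn`, `T ≈ α_c n`, and let
`h ≈ n/2`. Suppose that every `b`-set in `X` is below at least `T` of the vertices between `X` and
the middle, that the mirror image holds for `Y`, that any two `T`-sets in the lower and the upper
half are joined by an edge, and that no vertex has `m` vertices above it. Then any `b`-sets `A ⊆ X`
and `B ⊆ Y` contain comparable elements `a < c`, so each linear extension puts `X` below `Y` apart
from at most `b` exceptional elements on either side. If `|R| b + m ≤ k`, some `x ∈ X` is
exceptional for no order in `R`. It is then never reversed against the remaining `m` or more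
elements of `Y`, hence lies below all of them, a contradiction. With `m ≈ ξn/4` this gives `|R| ≥ ξ
/ (2β)` (`IsRealiser.card_lt`, `card_lt_of_isRealiser_graphOrder`).

The events are handled by union bounds (`binomialRandom_exists_isRealiser_le`). Inspecting the pool
in its order reveals disjoint sets of edges, so the number of reached vertices has an explicit law:
a Gaussian binomial coefficient times simple factors (`reachProb_mul_prod`). With `q = e^(-l)`, the
logarithms of its products are sums of `log (1 - e^(-ls))`, an increasing function with
antiderivative `Li₂(e^(-ls)) / l`. Comparison with integrals gives a bound `exp (n · exponent)` free
of error terms, and `exponent` tends to `f`. Negativity of the supremum of `f` on a compact interval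
then yields uniform exponential decay. The equation for `α_c` makes the union bound for missing
edges between `T`-sets small, and up-sets of single vertices have a geometric tail.

Part (b) for large `c` is part (a) with `ξ = 1/12` and `β = e^(-c/6) / 24`, where `ξ / (2β) =
e^(c/6)` exactly. For the other `c` it is enough that the dimension is a.a.s. at least 2. -/

/-! ### Estimates for the dilogarithm. -/

/-- Near `0` the quotient is bounded because `|log (1 - y)| ≤ 2|y|`; away from `0` the factor `y⁻¹`
is at most 2. Only the integrable singularity of the logarithm at `y = 1` remains. -/
theorem abs_inv_mul_log_one_sub_le (y : ℝ) :
    |y⁻¹ * Real.log (1 - y)| ≤ 2 + 2 * |Real.log (1 - y)| := by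
  rw [abs_mul, abs_inv]
  rcases le_total |y| (1 / 2) with h | h
  · rcases eq_or_ne y 0 with rfl | hy
    · simp
    have hy' : 0 < |y| := abs_pos.2 hy
    obtain ⟨h1, h2⟩ := abs_le.1 h
    have hlog : |Real.log (1 - y)| ≤ 2 * |y| := by
      have hu : Real.log (1 - y) ≤ |y| := by
        have := Real.log_le_sub_one_of_pos (show 0 < 1 - y by linarith)
        have := neg_abs_le y
        linarith
      have hl : -(2 * |y|) ≤ Real.log (1 - y) := by
        have h3 := Real.one_sub_inv_le_log_of_pos (show 0 < 1 - y by linarith)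
        have h4 : 1 - (1 - y)⁻¹ = -(y / (1 - y)) := by
          have : (1 - y) ≠ 0 := by linarith
          field_simp
          ring
        have h5 : y / (1 - y) ≤ 2 * |y| := by
          rw [div_le_iff₀ (by linarith)]
          have := le_abs_self y
          nlinarith
        linarith
      exact abs_le.2 ⟨hl, by linarith⟩
    calc |y|⁻¹ * |Real.log (1 - y)| ≤ |y|⁻¹ * (2 * |y|) := by gcongr
      _ = 2 := by field_simp
      _ ≤ _ := le_add_of_nonneg_right (by positivity)
  · have : |y|⁻¹ ≤ 2 := by
      rw [inv_le_comm₀ (by linarith) (by norm_num)]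
      linarith
    have h0 := abs_nonneg (Real.log (1 - y))
    nlinarith

theorem intervalIntegrable_inv_mul_log_one_sub (a b : ℝ) :
    IntervalIntegrable (fun y : ℝ => y⁻¹ * Real.log (1 - y)) MeasureTheory.volume a b := by
  have hlog : IntervalIntegrable (fun y : ℝ => Real.log (1 - y)) MeasureTheory.volume a b := by
    have h : IntervalIntegrable Real.log MeasureTheory.volume (1 - a) (1 - b) :=
      intervalIntegral.intervalIntegrable_log'
    simpa using h.comp_sub_left 1
  have hbound : IntervalIntegrable (fun y : ℝ => 2 + 2 * |Real.log (1 - y)|)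
      MeasureTheory.volume a b :=
    intervalIntegrable_const.add (hlog.abs.const_mul 2)
  refine hbound.mono_fun ?_ ?_
  · exact Measurable.aestronglyMeasurable (by fun_prop)
  · refine Eventually.of_forall fun y => ?_
    simp only [Real.norm_eq_abs]
    exact (abs_inv_mul_log_one_sub_le y).trans (le_abs_self _)

theorem continuous_Li2 : Continuous Li2 :=
  (intervalIntegral.continuous_primitive intervalIntegrable_inv_mul_log_one_sub 0).neg

theorem hasDerivAt_Li2 {z : ℝ} (h0 : 0 < z) (h1 : z < 1) :
    HasDerivAt Li2 (-(z⁻¹ * Real.log (1 - z))) z := by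
  refine HasDerivAt.neg ?_
  have hc : ContinuousOn (fun y : ℝ => y⁻¹ * Real.log (1 - y)) (Set.Ioo 0 1) := by
    refine ContinuousOn.mul (continuousOn_inv₀.mono fun y hy => hy.1.ne') ?_
    exact ContinuousOn.log (by fun_prop) fun y hy => by
      have := hy.2
      linarith
  have hm : Set.Ioo (0 : ℝ) 1 ∈ 𝓝 z := Ioo_mem_nhds h0 h1
  refine intervalIntegral.integral_hasDerivAt_right
    (intervalIntegrable_inv_mul_log_one_sub 0 z) ?_ (hc.continuousAt hm)
  exact hc.stronglyMeasurableAtFilter isOpen_Ioo z ⟨h0, h1⟩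

theorem hasDerivAt_Li2_exp {l s : ℝ} (hl : 0 < l) (hs : 0 < s) :
    HasDerivAt (fun s => 1 / l * Li2 (Real.exp (-(l * s))))
      (Real.log (1 - Real.exp (-(l * s)))) s := by
  have hls : 0 < l * s := mul_pos hl hs
  have h1 : HasDerivAt (fun s => Real.exp (-(l * s))) (Real.exp (-(l * s)) * (-l)) s := by
    have := ((hasDerivAt_id s).const_mul l).neg.exp
    simpa using this
  have h2 := (hasDerivAt_Li2 (Real.exp_pos (-(l * s))) (by simpa using hls)).comp s h1
  have h3 := h2.const_mul (1 / l)
  refine h3.congr_deriv ?_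
  have := Real.exp_pos (-(l * s))
  field_simp

theorem continuous_Li2_exp (l : ℝ) :
    Continuous fun s => 1 / l * Li2 (Real.exp (-(l * s))) :=
  continuous_const.mul (continuous_Li2.comp (by fun_prop))

theorem log_one_sub_exp_mono {l s t : ℝ} (hl : 0 < l) (hs : 0 < s) (hst : s ≤ t) :
    Real.log (1 - Real.exp (-(l * s))) ≤ Real.log (1 - Real.exp (-(l * t))) := by
  have h1 : Real.exp (-(l * s)) < 1 := by simpa using mul_pos hl hs
  have h2 : Real.exp (-(l * t)) ≤ Real.exp (-(l * s)) := by gcongr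
  exact Real.log_le_log (by linarith) (by linarith)

/-- The mean value theorem on `[s, s + 1]` for the antiderivative of `log (1 - e^(-l s))`. -/
theorem Li2_exp_step {l s : ℝ} (hl : 0 < l) (hs : 0 ≤ s) :
    1 / l * Li2 (Real.exp (-(l * (s + 1)))) - 1 / l * Li2 (Real.exp (-(l * s))) ≤
        Real.log (1 - Real.exp (-(l * (s + 1)))) ∧
      (0 < s → Real.log (1 - Real.exp (-(l * s))) ≤
        1 / l * Li2 (Real.exp (-(l * (s + 1)))) - 1 / l * Li2 (Real.exp (-(l * s)))) := by
  obtain ⟨u, hu, he⟩ := exists_hasDerivAt_eq_slope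
    (fun s => 1 / l * Li2 (Real.exp (-(l * s)))) _ (show s < s + 1 by linarith)
    (continuous_Li2_exp l).continuousOn
    fun x hx => hasDerivAt_Li2_exp hl (lt_of_le_of_lt hs hx.1)
  simp only [add_sub_cancel_left, div_one] at he
  rw [← he]
  exact ⟨log_one_sub_exp_mono hl (hs.trans_lt hu.1) hu.2.le,
    fun h0 => log_one_sub_exp_mono hl h0 hu.1.le⟩

theorem Li2_mono {y z : ℝ} (hy : 0 ≤ y) (hyz : y ≤ z) (hz : z ≤ 1) : Li2 y ≤ Li2 z := by
  have hmono : MonotoneOn Li2 (Set.Icc 0 1) := by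
    refine monotoneOn_of_deriv_nonneg (convex_Icc 0 1) continuous_Li2.continuousOn ?_ ?_
    · intro x hx
      rw [interior_Icc] at hx
      exact (hasDerivAt_Li2 hx.1 hx.2).differentiableAt.differentiableWithinAt
    · intro x hx
      rw [interior_Icc] at hx
      rw [(hasDerivAt_Li2 hx.1 hx.2).deriv]
      have h1 : Real.log (1 - x) ≤ 0 := Real.log_nonpos (by linarith [hx.2]) (by linarith [hx.1])
      have h2 : 0 < x⁻¹ := inv_pos.2 hx.1
      nlinarith
  exact hmono ⟨hy, hyz.trans hz⟩ ⟨hy.trans hyz, hz⟩ hyz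

/-- Right side minus left side vanishes at `u = 0` and has derivative `log 2 - log u + log (1 -
e^(-u))`, which is nonnegative since `1 - e^(-u) ≥ u/2` on `[0, 1]`. Used in part (b) with `u = cβ`.
-/
theorem Li2_one_sub_le {u : ℝ} (h0 : 0 < u) (h1 : u ≤ 1) :
    Li2 1 - Li2 (Real.exp (-u)) ≤ u * (Real.log 2 + 1 - Real.log u) := by
  let D : ℝ → ℝ := fun u => u * (Real.log 2 + 1) + Real.negMulLog u + Li2 (Real.exp (-u))
  have hD : MonotoneOn D (Set.Icc 0 1) := by
    have hd : ∀ x ∈ Set.Ioo (0 : ℝ) 1, HasDerivAt D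
        (Real.log 2 - Real.log x + Real.log (1 - Real.exp (-x))) x := by
      intro x hx
      have h3 := hasDerivAt_Li2_exp one_pos hx.1
      simp only [one_mul, div_one] at h3
      have h4 := (((hasDerivAt_id x).mul_const (Real.log 2 + 1)).add
        (Real.hasDerivAt_negMulLog hx.1.ne')).add h3
      refine h4.congr_deriv ?_
      ring
    refine monotoneOn_of_deriv_nonneg (convex_Icc 0 1) ?_ ?_ ?_
    · refine Continuous.continuousOn (Continuous.add (Continuous.add (by fun_prop)
        Real.continuous_negMulLog) (continuous_Li2.comp (by fun_prop)))
    · intro x hx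
      rw [interior_Icc] at hx
      exact (hd x hx).differentiableAt.differentiableWithinAt
    · intro x hx
      rw [interior_Icc] at hx
      rw [(hd x hx).deriv]
      have h5 : x / 2 ≤ 1 - Real.exp (-x) := by
        have h6 : 1 + x ≤ Real.exp x := by linarith [Real.add_one_le_exp x]
        have h7 : Real.exp (-x) ≤ (1 + x)⁻¹ := by
          rw [Real.exp_neg]
          exact inv_anti₀ (by linarith [hx.1]) h6
        have h8 : (1 + x)⁻¹ ≤ 1 - x / 2 := by
          rw [inv_le_iff_one_le_mul₀ (by linarith [hx.1])]
          nlinarith [hx.1, hx.2]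
        linarith
      have h9 := Real.log_le_log (by linarith [hx.1]) h5
      rw [Real.log_div hx.1.ne' two_ne_zero] at h9
      linarith
  have := hD (Set.left_mem_Icc.2 zero_le_one) ⟨h0.le, h1⟩ h0.le
  simp only [D, Real.negMulLog, zero_mul, neg_zero, Real.exp_zero, zero_add] at this
  linarith

/-! ### The law of the number of reached vertices. -/

/-- The probability that a random exploration which starts from `b` vertices reaches exactly `t`
vertices of a pool of size `M`: the pool is inspected in order, and a vertex is reached unless it
is joined to none of the starting vertices and none of the vertices reached before. -/
def reachProb (q : ℝ) (b : ℕ) : ℕ → ℕ → ℝ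
  | 0, 0 => 1
  | 0, _ + 1 => 0
  | M + 1, 0 => q ^ b * reachProb q b M 0
  | M + 1, t + 1 =>
    q ^ (b + (t + 1)) * reachProb q b M (t + 1) + (1 - q ^ (b + t)) * reachProb q b M t

theorem reachProb_eq_zero (q : ℝ) (b : ℕ) {M t : ℕ} (h : M < t) : reachProb q b M t = 0 := by
  induction M generalizing t with
  | zero =>
    obtain ⟨t, rfl⟩ := Nat.exists_eq_succ_of_ne_zero h.ne'
    rfl
  | succ M ih =>
    obtain ⟨t, rfl⟩ := Nat.exists_eq_succ_of_ne_zero (Nat.ne_of_gt (Nat.zero_lt_of_lt h))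
    rw [reachProb, ih (by omega), ih (by omega)]
    ring

/-- After division this is `q^(bm) ∏ (1 - q^(b+i))` times the Gaussian binomial coefficient of `m +
t` over `t`. The double induction is its Pascal rule: `q^(t+1) (1 - q^(m+1)) + (1 - q^(t+1)) = 1 -
q^(m+t+2)`. -/
theorem reachProb_mul_prod (q : ℝ) (b m t : ℕ) :
    reachProb q b (m + t) t * ∏ i ∈ Finset.range t, (1 - q ^ (i + 1)) =
      q ^ (b * m) * (∏ i ∈ Finset.range t, (1 - q ^ (b + i))) *
        ∏ i ∈ Finset.range t, (1 - q ^ (m + i + 1)) := by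
  induction m generalizing t with
  | zero =>
    simp only [zero_add, mul_zero, pow_zero, one_mul]
    congr 1
    induction t with
    | zero => simp [reachProb]
    | succ t ih =>
      rw [reachProb, reachProb_eq_zero q b (Nat.lt_succ_self t), ih, Finset.prod_range_succ]
      ring
  | succ m ihm =>
    induction t with
    | zero =>
      have := ihm 0
      simp only [Finset.range_zero, Finset.prod_empty, mul_one, add_zero] at this ⊢
      rw [reachProb, this]
      ring
    | succ t iht =>
      have h1 := ihm (t + 1)
      rw [show m + 1 + (t + 1) = (m + (t + 1)) + 1 by ring, reachProb]
      rw [show m + (t + 1) = m + 1 + t by ring] at h1 ⊢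
      rw [add_mul, mul_assoc, h1, Finset.prod_range_succ (fun i => 1 - q ^ (i + 1)),
        Finset.prod_range_succ (fun i => 1 - q ^ (b + i)),
        Finset.prod_range_succ' (fun i => 1 - q ^ (m + i + 1)),
        Finset.prod_range_succ (fun i => 1 - q ^ (m + 1 + i + 1)),
        show (1 - q ^ (b + t)) * reachProb q b (m + 1 + t) t *
          ((∏ i ∈ Finset.range t, (1 - q ^ (i + 1))) * (1 - q ^ (t + 1))) =
          (1 - q ^ (b + t)) * (1 - q ^ (t + 1)) * (reachProb q b (m + 1 + t) t *
          (∏ i ∈ Finset.range t, (1 - q ^ (i + 1)))) by ring, iht]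
      rw [Finset.prod_congr rfl fun i _ => show 1 - q ^ (m + (i + 1) + 1) =
        1 - q ^ (m + 1 + i + 1) by ring_nf]
      ring

/-- For a single starting vertex the product `∏ (1 - q^(b+i))` cancels the denominator, leaving
`q^m` and `t` factors that are each at most `1 - q^M`. -/
theorem reachProb_one_le {q : ℝ} (h0 : 0 < q) (h1 : q < 1) (M t : ℕ) :
    reachProb q 1 M t ≤ (1 - q ^ M) ^ t := by
  have hM : 0 ≤ 1 - q ^ M := sub_nonneg.2 (pow_le_one₀ h0.le h1.le)
  rcases lt_or_ge M t with h | h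
  · rw [reachProb_eq_zero q 1 h]
    positivity
  obtain ⟨m, rfl⟩ := Nat.exists_eq_add_of_le' h
  have hpos : 0 < ∏ i ∈ Finset.range t, (1 - q ^ (i + 1)) :=
    Finset.prod_pos fun i _ => sub_pos.2 (pow_lt_one₀ h0.le h1 (Nat.succ_ne_zero i))
  have h2 := reachProb_mul_prod q 1 m t
  rw [Finset.prod_congr rfl fun i _ => show 1 - q ^ (1 + i) = 1 - q ^ (i + 1) by
    rw [add_comm]] at h2
  have h3 : reachProb q 1 (m + t) t =
      q ^ (1 * m) * ∏ i ∈ Finset.range t, (1 - q ^ (m + i + 1)) := by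
    refine mul_right_cancel₀ hpos.ne' (h2.trans ?_)
    ring
  rw [h3]
  calc q ^ (1 * m) * ∏ i ∈ Finset.range t, (1 - q ^ (m + i + 1))
      ≤ 1 * ∏ i ∈ Finset.range t, (1 - q ^ (m + t)) := by
        refine mul_le_mul (pow_le_one₀ h0.le h1.le) ?_ ?_ zero_le_one
        · refine Finset.prod_le_prod (fun i _ => sub_nonneg.2 (pow_le_one₀ h0.le h1.le)) ?_
          intro i hi
          have := Finset.mem_range.1 hi
          exact sub_le_sub_left (pow_le_pow_of_le_one h0.le h1.le (by omega)) 1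
        · exact Finset.prod_nonneg fun i _ => sub_nonneg.2 (pow_le_one₀ h0.le h1.le)
    _ = (1 - q ^ (m + t)) ^ t := by simp

/-! ### Dilogarithm bounds for the products. -/

theorem one_sub_exp_pow_pos {l : ℝ} (hl : 0 < l) {n : ℕ} (hn : 0 < n) :
    0 < 1 - Real.exp (-l) ^ n := by
  rw [sub_pos]
  exact pow_lt_one₀ (Real.exp_pos _).le (by simpa using hl) hn.ne'

theorem exp_neg_pow (l : ℝ) (n : ℕ) : Real.exp (-l) ^ n = Real.exp (-(l * n)) := by
  rw [← Real.exp_nat_mul]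
  ring_nf

/-- A left-endpoint Riemann sum of an increasing function is at most the integral; `0 < a` keeps the
first endpoint off the singularity of the logarithm. -/
theorem prod_one_sub_exp_pow_le {l : ℝ} (hl : 0 < l) {a : ℕ} (ha : 0 < a) (t : ℕ) :
    ∏ i ∈ Finset.range t, (1 - Real.exp (-l) ^ (a + i)) ≤
      Real.exp (1 / l * Li2 (Real.exp (-(l * (a + t)))) - 1 / l * Li2 (Real.exp (-(l * a)))) := by
  induction t with
  | zero => simp
  | succ t ih =>
    have hpos := one_sub_exp_pow_pos hl (show 0 < a + t by omega)
    have hstep := (Li2_exp_step hl (show (0 : ℝ) ≤ a + t by positivity)).2 (by positivity)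
    have h1 : 1 - Real.exp (-l) ^ (a + t) ≤
        Real.exp (1 / l * Li2 (Real.exp (-(l * (a + t + 1)))) -
          1 / l * Li2 (Real.exp (-(l * (a + t))))) := by
      rw [← Real.log_le_iff_le_exp hpos, exp_neg_pow]
      push_cast
      exact hstep
    rw [Finset.prod_range_succ]
    refine (mul_le_mul ih h1 hpos.le (Real.exp_pos _).le).trans_eq ?_
    rw [← Real.exp_add]
    push_cast
    rw [← add_assoc]
    ring_nf

/-- Here the indices are right endpoints, so the sum dominates the integral, and the integral may
start at the singularity `0`. This bounds the denominator of `reachProb`. -/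
theorem le_prod_one_sub_exp_pow {l : ℝ} (hl : 0 < l) (t : ℕ) :
    Real.exp (1 / l * Li2 (Real.exp (-(l * t))) - 1 / l * Li2 1) ≤
      ∏ i ∈ Finset.range t, (1 - Real.exp (-l) ^ (i + 1)) := by
  induction t with
  | zero => simp
  | succ t ih =>
    have hpos := one_sub_exp_pow_pos hl (show 0 < t + 1 by omega)
    have hstep := (Li2_exp_step hl (show (0 : ℝ) ≤ t by positivity)).1
    have h1 : Real.exp (1 / l * Li2 (Real.exp (-(l * (t + 1)))) -
          1 / l * Li2 (Real.exp (-(l * t)))) ≤ 1 - Real.exp (-l) ^ (t + 1) := by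
      rw [← Real.le_log_iff_exp_le hpos, exp_neg_pow]
      push_cast
      exact hstep
    rw [Finset.prod_range_succ]
    refine Eq.trans_le ?_ (mul_le_mul ih h1 (Real.exp_pos _).le ?_)
    · rw [← Real.exp_add]
      push_cast
      ring_nf
    · exact Finset.prod_nonneg fun i _ => (one_sub_exp_pow_pos hl (Nat.succ_pos i)).le

theorem reachProb_le_exp {l : ℝ} (hl : 0 < l) {b : ℕ} (hb : 0 < b) (m t : ℕ) :
    reachProb (Real.exp (-l)) b (m + t) t ≤
      Real.exp (-(l * b * m) + 1 / l * (Li2 1 - Li2 (Real.exp (-(l * t)))) +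
        1 / l * (Li2 (Real.exp (-(l * (b + t)))) - Li2 (Real.exp (-(l * b))) +
          Li2 (Real.exp (-(l * (m + 1 + t)))) - Li2 (Real.exp (-(l * (m + 1)))))) := by
  have h1 := le_prod_one_sub_exp_pow hl t
  have h2 := prod_one_sub_exp_pow_le hl hb t
  have h3 := prod_one_sub_exp_pow_le hl (Nat.succ_pos m) t
  rw [Finset.prod_congr rfl fun i _ => show 1 - Real.exp (-l) ^ (m.succ + i) =
    1 - Real.exp (-l) ^ (m + i + 1) by congr 2; omega] at h3
  push_cast at h3
  have h4 := reachProb_mul_prod (Real.exp (-l)) b m t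
  have h5 : 0 < ∏ i ∈ Finset.range t, (1 - Real.exp (-l) ^ (i + 1)) :=
    (Real.exp_pos _).trans_le h1
  have h6 : 0 ≤ ∏ i ∈ Finset.range t, (1 - Real.exp (-l) ^ (m + i + 1)) :=
    Finset.prod_nonneg fun i _ => (one_sub_exp_pow_pos hl (Nat.succ_pos _)).le
  rw [← eq_div_iff h5.ne'] at h4
  rw [h4, div_le_iff₀ h5]
  refine le_trans ?_ (mul_le_mul_of_nonneg_left h1 (Real.exp_pos _).le)
  rw [mul_assoc, exp_neg_pow]
  refine (mul_le_mul_of_nonneg_left (mul_le_mul h2 h3 h6 (Real.exp_pos _).le)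
    (Real.exp_pos _).le).trans_eq ?_
  rw [← Real.exp_add, ← Real.exp_add, ← Real.exp_add]
  push_cast
  ring_nf

/-- Combines `k.choose b ≤ k^b / b!` with `b^b / b! ≤ e^b`. -/
theorem choose_le_exp {k b : ℕ} (hk : 0 < k) (hb : 0 < b) :
    (k.choose b : ℝ) ≤ Real.exp (b * Real.log (Real.exp 1 * k / b)) := by
  have h1 : (k.choose b : ℝ) ≤ k ^ b / b.factorial := Nat.choose_le_pow_div b k
  have h2 := Real.pow_div_factorial_le_exp (b : ℝ) (Nat.cast_nonneg b) b
  have hb' : (0 : ℝ) < b := Nat.cast_pos.2 hb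
  have hk' : (0 : ℝ) < k := Nat.cast_pos.2 hk
  refine h1.trans ?_
  rw [Real.exp_nat_mul, Real.exp_log (by positivity), div_pow, mul_pow, ← Real.exp_nat_mul, mul_one]
  have hf : (0 : ℝ) < b.factorial := by positivity
  rw [div_le_iff₀ hf] at h2 ⊢
  rw [div_mul_eq_mul_div, le_div_iff₀ (by positivity)]
  nlinarith [pow_pos hk' b]

open MeasureTheory

/-! ### Events of the binomial random graph and union bounds. -/

section Probability

variable {V : Type*}

theorem measurableSet_simpleGraph [Finite V] (B : Set (SimpleGraph V)) : MeasurableSet B := by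
  rw [← SimpleGraph.measurableEmbedding_edgeSet.measurableSet_image]
  exact (Set.toFinite _).measurableSet

theorem binomialRandom_forall_notMem [Finite V] (p : unitInterval) (F : Finset (Sym2 V))
    (hF : ∀ e ∈ F, ¬ e.IsDiag) :
    (SimpleGraph.binomialRandom V p).real {G | ∀ e ∈ F, e ∉ G.edgeSet} =
      (1 - p : ℝ) ^ F.card := by
  have hmeas : MeasurableSet {G : SimpleGraph V | ∀ e ∈ F, e ∉ G.edgeSet} :=
    measurableSet_simpleGraph _
  rw [SimpleGraph.binomialRandom_eq_map, measureReal_def,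
    Measure.map_apply SimpleGraph.measurable_fromEdgeSet hmeas,
    ProbabilityTheory.setBernoulli_apply']
  have hset : (fun P : Sym2 V → Prop => {i | P i}) ⁻¹' (SimpleGraph.fromEdgeSet ⁻¹'
      {G : SimpleGraph V | ∀ e ∈ F, e ∉ G.edgeSet}) = Set.pi F fun _ => {False} := by
    ext P
    simp only [Set.mem_preimage, Set.mem_ofPred_eq, SimpleGraph.edgeSet_fromEdgeSet, Set.mem_pi,
      Set.mem_singleton_iff, eq_iff_iff, iff_false, SetLike.mem_coe]
    refine forall₂_congr fun e he => ?_
    have := hF e he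
    simp_all
  rw [hset, Measure.infinitePi_pi _ fun _ _ => MeasurableSpace.measurableSet_top]
  rw [Finset.prod_congr rfl (g := fun _ => ((unitInterval.toNNReal (unitInterval.symm p) : NNReal) :
    ENNReal))]
  · simp
  · intro e he
    simp [hF e he]

/-- Independence is obtained by complementation: "some edge of `E j`" is everything minus "no edge
of `E j`", and in the latter event `E j` is absorbed into `F`. Induction on `J` thus needs only the
probability that a given set of edges is absent. -/
theorem binomialRandom_forall_notMem_exists_mem [Finite V] {ι : Type*} (p : unitInterval)
    (J : Finset ι) (E : ι → Finset (Sym2 V)) (F : Finset (Sym2 V))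
    (hE : ∀ j ∈ J, ∀ e ∈ E j, ¬ e.IsDiag) (hF : ∀ e ∈ F, ¬ e.IsDiag)
    (hEE : (J : Set ι).PairwiseDisjoint E) (hEF : ∀ j ∈ J, Disjoint F (E j)) :
    (SimpleGraph.binomialRandom V p).real
        {G | (∀ e ∈ F, e ∉ G.edgeSet) ∧ ∀ j ∈ J, ∃ e ∈ E j, e ∈ G.edgeSet} =
      (1 - p : ℝ) ^ F.card * ∏ j ∈ J, (1 - (1 - p : ℝ) ^ (E j).card) := by
  classical
  induction J using Finset.induction_on generalizing F with
  | empty => simpa using binomialRandom_forall_notMem p F hF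
  | insert j J hj ih =>
    have hEE' : (J : Set ι).PairwiseDisjoint E := hEE.subset (by simp)
    have hE' : ∀ i ∈ J, ∀ e ∈ E i, ¬ e.IsDiag := fun i hi => hE i (Finset.mem_insert_of_mem hi)
    have h1 := ih F hE' hF hEE' fun i hi => hEF i (Finset.mem_insert_of_mem hi)
    have h2 := ih (F ∪ E j) hE' (fun e he => (Finset.mem_union.1 he).elim (hF e)
      (hE j (Finset.mem_insert_self j J) e)) hEE' fun i hi => by
        rw [Finset.disjoint_union_left]
        refine ⟨hEF i (Finset.mem_insert_of_mem hi), hEE (by simp) (by simp [hi]) ?_⟩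
        rintro rfl
        exact hj hi
    have hset : {G : SimpleGraph V | (∀ e ∈ F, e ∉ G.edgeSet) ∧
          ∀ i ∈ insert j J, ∃ e ∈ E i, e ∈ G.edgeSet} =
        {G : SimpleGraph V | (∀ e ∈ F, e ∉ G.edgeSet) ∧ ∀ i ∈ J, ∃ e ∈ E i, e ∈ G.edgeSet} \
        {G : SimpleGraph V | (∀ e ∈ F ∪ E j, e ∉ G.edgeSet) ∧
          ∀ i ∈ J, ∃ e ∈ E i, e ∈ G.edgeSet} := by
      ext G
      simp only [Set.mem_ofPred_eq, Finset.forall_mem_insert, Set.mem_sdiff, Finset.mem_union]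
      constructor
      · rintro ⟨hG, ⟨e, he, heG⟩, hJ⟩
        exact ⟨⟨hG, hJ⟩, fun h => h.1 e (Or.inr he) heG⟩
      · rintro ⟨⟨hG, hJ⟩, h⟩
        refine ⟨hG, ?_, hJ⟩
        by_contra! hcon
        exact h ⟨fun e he => he.elim (hG e) (hcon e), hJ⟩
    rw [hset, measureReal_sdiff ?_ (measurableSet_simpleGraph _) (measure_ne_top _ _), h1, h2,
      Finset.card_union_of_disjoint (hEF j (Finset.mem_insert_self j J)),
      Finset.prod_insert hj, pow_add]
    · ring
    · exact fun G hG => ⟨fun e he => hG.1 e (Finset.mem_union_left _ he), hG.2⟩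

/-- `S` is the set of (indices of) vertices reached from `A` when the pool `w 0, …, w (M - 1)` is
inspected in this order. -/
def IsReached (G : SimpleGraph V) (w : ℕ → V) (M : ℕ) (A : Finset V) (S : Finset ℕ) : Prop :=
  S ⊆ Finset.range M ∧
    ∀ j < M, j ∈ S ↔ (∃ a ∈ A, G.Adj a (w j)) ∨ ∃ i ∈ S, i < j ∧ G.Adj (w i) (w j)

theorem exists_isReached (G : SimpleGraph V) (w : ℕ → V) (M : ℕ) (A : Finset V) :
    ∃ S, IsReached G w M A S := by
  classical
  induction M with
  | zero => exact ⟨∅, by simp [IsReached]⟩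
  | succ M ih =>
    obtain ⟨S, hS, hiff⟩ := ih
    have hlt : ∀ i ∈ S, i < M := fun i hi => Finset.mem_range.1 (hS hi)
    have hM : M ∉ S := fun h => lt_irrefl _ (hlt M h)
    by_cases h : (∃ a ∈ A, G.Adj a (w M)) ∨ ∃ i ∈ S, i < M ∧ G.Adj (w i) (w M)
    · refine ⟨insert M S, ?_, ?_⟩
      · intro i hi
        rcases Finset.mem_insert.1 hi with rfl | hi
        · simp
        · exact Finset.mem_range.2 ((hlt i hi).trans (Nat.lt_succ_self M))
      · intro j hj
        rcases Nat.lt_succ_iff_lt_or_eq.1 hj with hj | rfl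
        · rw [Finset.mem_insert, hiff j hj]
          simp only [Finset.mem_insert, exists_eq_or_imp]
          constructor
          · rintro (rfl | h)
            · omega
            · exact h.imp_right Or.inr
          · rintro (h | h | h)
            · exact Or.inr (Or.inl h)
            · omega
            · exact Or.inr (Or.inr h)
        · refine iff_of_true (Finset.mem_insert_self _ _) (h.imp_right ?_)
          rintro ⟨i, hi, h'⟩
          exact ⟨i, Finset.mem_insert_of_mem hi, h'⟩
    · refine ⟨S, hS.trans (Finset.range_mono (Nat.le_succ M)), ?_⟩
      intro j hj
      rcases Nat.lt_succ_iff_lt_or_eq.1 hj with hj | rfl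
      · exact hiff j hj
      · exact iff_of_false hM h

/-- The probability that exactly the indices in `S` are reached from `b` vertices. -/
def setReachProb (q : ℝ) (b M : ℕ) (S : Finset ℕ) : ℝ :=
  ∏ j ∈ Finset.range M, if j ∈ S then 1 - q ^ (b + (S.filter (· < j)).card)
    else q ^ (b + (S.filter (· < j)).card)

/-- Once `S` is fixed, the condition at `j` concerns only the edges from `w j` to `A` and to earlier
members of `S`. These edge sets are disjoint for different `j`, so the probability factorises. -/
theorem binomialRandom_isReached [Finite V] (p : unitInterval) (w : ℕ → V) (M : ℕ) (A : Finset V)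
    (S : Finset ℕ) (hw : Set.InjOn w (Set.Iio M)) (hA : ∀ j < M, w j ∉ A)
    (hS : S ⊆ Finset.range M) :
    (SimpleGraph.binomialRandom V p).real {G | IsReached G w M A S} =
      setReachProb (1 - p) A.card M S := by
  classical
  have hlt : ∀ i ∈ S, i < M := fun i hi => Finset.mem_range.1 (hS hi)
  let N : ℕ → Finset V := fun j => A ∪ (S.filter (· < j)).image w
  let E : ℕ → Finset (Sym2 V) := fun j => (N j).image fun v => s(v, w j)
  have hN : ∀ j < M, w j ∉ N j := by
    intro j hj h
    rcases Finset.mem_union.1 h with h | h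
    · exact hA j hj h
    · obtain ⟨i, hi, h⟩ := Finset.mem_image.1 h
      obtain ⟨hiS, hij⟩ := Finset.mem_filter.1 hi
      have := hw (hlt i hiS) hj h
      omega
  have hcard : ∀ j < M, (E j).card = A.card + (S.filter (· < j)).card := by
    intro j hj
    rw [Finset.card_image_of_injOn, Finset.card_union_of_disjoint, Finset.card_image_of_injOn]
    · intro i hi i' hi' h
      exact hw (hlt i (Finset.mem_filter.1 hi).1) (hlt i' (Finset.mem_filter.1 hi').1) h
    · rw [Finset.disjoint_left]
      intro a ha h
      obtain ⟨i, hi, rfl⟩ := Finset.mem_image.1 h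
      exact hA i (hlt i (Finset.mem_filter.1 hi).1) ha
    · intro v _ v' _ h
      exact Sym2.congr_left.1 h
  have hdiag : ∀ j < M, ∀ e ∈ E j, ¬ e.IsDiag := by
    intro j hj e he
    obtain ⟨v, hv, rfl⟩ := Finset.mem_image.1 he
    rw [Sym2.mk_isDiag_iff]
    rintro rfl
    exact hN j hj hv
  have hdisj : ∀ j < M, ∀ j' < M, j < j' → Disjoint (E j) (E j') := by
    intro j hj j' hj' hjj
    rw [Finset.disjoint_left]
    intro e he he'
    obtain ⟨v, hv, rfl⟩ := Finset.mem_image.1 he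
    obtain ⟨v', hv', h⟩ := Finset.mem_image.1 he'
    rcases Sym2.eq_iff.1 h with ⟨-, h⟩ | ⟨-, h⟩
    · exact hjj.ne' (hw hj' hj h)
    · rw [← h] at hv
      rcases Finset.mem_union.1 hv with h | h
      · exact hA j' hj' h
      · obtain ⟨i, hi, h⟩ := Finset.mem_image.1 h
        obtain ⟨hiS, hij⟩ := Finset.mem_filter.1 hi
        have := hw (hlt i hiS) hj' h
        omega
  have hdisj' : ∀ j < M, ∀ j' < M, j ≠ j' → Disjoint (E j) (E j') := by
    intro j hj j' hj' hjj
    rcases lt_or_gt_of_ne hjj with h | h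
    · exact hdisj j hj j' hj' h
    · exact (hdisj j' hj' j hj h).symm
  let F : Finset (Sym2 V) := (Finset.range M \ S).biUnion E
  have hset : {G : SimpleGraph V | IsReached G w M A S} =
      {G | (∀ e ∈ F, e ∉ G.edgeSet) ∧ ∀ j ∈ S, ∃ e ∈ E j, e ∈ G.edgeSet} := by
    ext G
    have hadj : ∀ j, ((∃ a ∈ A, G.Adj a (w j)) ∨ ∃ i ∈ S, i < j ∧ G.Adj (w i) (w j)) ↔
        ∃ e ∈ E j, e ∈ G.edgeSet := by
      intro j
      simp only [E, N, Finset.mem_union, or_and_right, exists_or, Finset.mem_image,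
        Finset.mem_filter]
      aesop
    simp only [Set.mem_ofPred_eq, IsReached, hadj, F, Finset.mem_biUnion, Finset.mem_sdiff,
      Finset.mem_range]
    constructor
    · rintro ⟨-, h⟩
      refine ⟨?_, fun j hj => (h j (hlt j hj)).1 hj⟩
      rintro e ⟨j, ⟨hjM, hjS⟩, he⟩ heG
      exact hjS ((h j hjM).2 ⟨e, he, heG⟩)
    · rintro ⟨h1, h2⟩
      refine ⟨hS, fun j hj => ⟨h2 j, ?_⟩⟩
      rintro ⟨e, he, heG⟩
      by_contra hjS
      exact h1 e ⟨j, ⟨hj, hjS⟩, he⟩ heG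
  rw [hset, binomialRandom_forall_notMem_exists_mem]
  · rw [setReachProb, Finset.card_biUnion, ← Finset.prod_pow_eq_pow_sum, Finset.prod_ite,
      Finset.filter_notMem_eq_sdiff, Finset.filter_mem_eq_inter, Finset.inter_eq_right.2 hS, mul_comm]
    · congr 1
      · exact Finset.prod_congr rfl fun j hj => by rw [hcard j (hlt j hj)]
      · exact Finset.prod_congr rfl fun j hj => by
          rw [hcard j (Finset.mem_range.1 (Finset.mem_sdiff.1 hj).1)]
    · intro i hi j hj hij
      exact hdisj' i (Finset.mem_range.1 (Finset.mem_sdiff.1 hi).1) j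
        (Finset.mem_range.1 (Finset.mem_sdiff.1 hj).1) hij
  · exact fun j hj => hdiag j (hlt j hj)
  · intro e he
    obtain ⟨j, hj, he⟩ := Finset.mem_biUnion.1 he
    exact hdiag j (Finset.mem_range.1 (Finset.mem_sdiff.1 hj).1) e he
  · exact fun i hi j hj hij => hdisj' i (hlt i hi) j (hlt j hj) hij
  · intro j hj
    rw [Finset.disjoint_biUnion_left]
    intro i hi
    refine hdisj' i (Finset.mem_range.1 (Finset.mem_sdiff.1 hi).1) j (hlt j hj) ?_
    rintro rfl
    exact (Finset.mem_sdiff.1 hi).2 hj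

theorem setReachProb_succ (q : ℝ) (b M : ℕ) (S : Finset ℕ) (hS : S ⊆ Finset.range M) :
    setReachProb q b (M + 1) S = q ^ (b + S.card) * setReachProb q b M S ∧
      setReachProb q b (M + 1) (insert M S) = (1 - q ^ (b + S.card)) * setReachProb q b M S := by
  have hlt : ∀ i ∈ S, i < M := fun i hi => Finset.mem_range.1 (hS hi)
  have hM : M ∉ S := fun h => lt_irrefl _ (hlt M h)
  have hf : S.filter (· < M) = S := Finset.filter_true_of_mem hlt
  constructor
  · rw [setReachProb, Finset.prod_range_succ, if_neg hM, hf, mul_comm, setReachProb]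
  · rw [setReachProb, Finset.prod_range_succ, if_pos (Finset.mem_insert_self M S),
      Finset.filter_insert, if_neg (lt_irrefl M), hf, mul_comm, setReachProb]
    congr 1
    refine Finset.prod_congr rfl fun j hj => ?_
    have hjM := Finset.mem_range.1 hj
    rw [Finset.filter_insert, if_neg (not_lt.2 hjM.le)]
    simp [Finset.mem_insert, hjM.ne]

/-- Splitting by whether the last pool vertex is reached reproduces the recursion of `reachProb`. -/
theorem sum_setReachProb (q : ℝ) (b M t : ℕ) :
    ∑ S ∈ (Finset.range M).powersetCard t, setReachProb q b M S = reachProb q b M t := by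
  induction M generalizing t with
  | zero =>
    cases t with
    | zero => simp [setReachProb, reachProb]
    | succ t => rw [Finset.powersetCard_eq_empty.2 (by simp), Finset.sum_empty, reachProb]
  | succ M ih =>
    cases t with
    | zero =>
      rw [reachProb, ← ih 0]
      simp [(setReachProb_succ q b M ∅ (by simp)).1]
    | succ t =>
      have hM : M ∉ Finset.range M := by simp
      rw [Finset.range_add_one, Finset.powersetCard_succ_insert hM, Finset.sum_union, reachProb,
        ← ih, ← ih, Finset.mul_sum, Finset.mul_sum, Finset.sum_image]
      · congr 1
        · refine Finset.sum_congr rfl fun S hS => ?_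
          obtain ⟨hS, hc⟩ := Finset.mem_powersetCard.1 hS
          rw [(setReachProb_succ q b M S hS).1, hc]
        · refine Finset.sum_congr rfl fun S hS => ?_
          obtain ⟨hS, hc⟩ := Finset.mem_powersetCard.1 hS
          rw [(setReachProb_succ q b M S hS).2, hc]
      · intro S hS S' hS' h
        have h1 : M ∉ S := fun h => hM ((Finset.mem_powersetCard.1 hS).1 h)
        have h2 : M ∉ S' := fun h => hM ((Finset.mem_powersetCard.1 hS').1 h)
        rw [← Finset.erase_insert h1, ← Finset.erase_insert h2, h]
      · rw [Finset.disjoint_left]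
        intro S hS hS'
        obtain ⟨S', -, rfl⟩ := Finset.mem_image.1 hS'
        exact hM ((Finset.mem_powersetCard.1 hS).1 (Finset.mem_insert_self _ _))

theorem measureReal_mono_biUnion {α ι : Type*} [MeasurableSpace α] (μ : Measure α)
    [IsFiniteMeasure μ] (I : Finset ι) (B : Set α) (C : ι → Set α)
    (h : ∀ x ∈ B, ∃ i ∈ I, x ∈ C i) : μ.real B ≤ ∑ i ∈ I, μ.real (C i) := by
  refine (measureReal_mono (s₂ := ⋃ i ∈ I, C i) ?_ (measure_ne_top _ _)).trans (measureReal_biUnion_finset_le I C)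
  intro x hx
  simpa using h x hx

/-- Union bound over the starting sets `A ⊆ X` of size `b` and the numbers `t ∈ I` of reached
vertices. -/
theorem binomialRandom_exists_isReached_le [Finite V] (p : unitInterval) (w : ℕ → V) (M : ℕ) (X : Finset V)
    (b : ℕ) (I : Finset ℕ) (hw : Set.InjOn w (Set.Iio M)) (hX : ∀ j < M, w j ∉ X) :
    (SimpleGraph.binomialRandom V p).real
        {G | ∃ A ⊆ X, A.card = b ∧ ∃ S, S.card ∈ I ∧ IsReached G w M A S} ≤
      X.card.choose b * ∑ t ∈ I, reachProb (1 - p) b M t := by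
  refine (measureReal_mono_biUnion _ (X.powersetCard b) _ (fun A =>
    {G | ∃ S, S.card ∈ I ∧ IsReached G w M A S}) ?_).trans ?_
  · rintro G ⟨A, hA, hb, h⟩
    exact ⟨A, Finset.mem_powersetCard.2 ⟨hA, hb⟩, h⟩
  rw [← Finset.card_powersetCard, ← nsmul_eq_mul]
  refine Finset.sum_le_card_nsmul _ _ _ fun A hA => ?_
  obtain ⟨hAX, rfl⟩ := Finset.mem_powersetCard.1 hA
  refine (measureReal_mono_biUnion _ I _ (fun t =>
    {G | ∃ S, S.card = t ∧ IsReached G w M A S}) ?_).trans ?_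
  · rintro G ⟨S, hS, h⟩
    exact ⟨_, hS, S, rfl, h⟩
  refine Finset.sum_le_sum fun t _ => ?_
  rw [← sum_setReachProb]
  refine (measureReal_mono_biUnion _ ((Finset.range M).powersetCard t) _ (fun S =>
    {G | IsReached G w M A S}) ?_).trans_eq ?_
  · rintro G ⟨S, hS, h⟩
    exact ⟨S, Finset.mem_powersetCard.2 ⟨h.1, hS⟩, h⟩
  · refine Finset.sum_congr rfl fun S hS => ?_
    exact binomialRandom_isReached p w M A S hw (fun j hj h => hX j hj (hAX h))
      (Finset.mem_powersetCard.1 hS).1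

/-- Union bound over the pairs of sets of size `T` in two disjoint sets with no edge between
them. -/
theorem binomialRandom_exists_no_edge_le [Finite V] (p : unitInterval) (X Y : Finset V) (hXY : Disjoint X Y)
    (T : ℕ) :
    (SimpleGraph.binomialRandom V p).real
        {G | ∃ A ⊆ X, A.card = T ∧ ∃ B ⊆ Y, B.card = T ∧ ∀ a ∈ A, ∀ b ∈ B, ¬ G.Adj a b} ≤
      X.card.choose T * Y.card.choose T * (1 - p : ℝ) ^ (T * T) := by
  classical
  refine (measureReal_mono_biUnion _ (X.powersetCard T ×ˢ Y.powersetCard T) _ (fun AB =>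
    {G | ∀ a ∈ AB.1, ∀ b ∈ AB.2, ¬ G.Adj a b}) ?_).trans ?_
  · rintro G ⟨A, hA, hAT, B, hB, hBT, h⟩
    exact ⟨(A, B), by simp [Finset.mem_powersetCard, *], h⟩
  have hcard : (X.card.choose T : ℝ) * Y.card.choose T =
      (X.powersetCard T ×ˢ Y.powersetCard T).card := by
    simp [Finset.card_product]
  rw [hcard, ← nsmul_eq_mul]
  refine Finset.sum_le_card_nsmul _ _ _ ?_
  rintro ⟨A, B⟩ h
  simp only [Finset.mem_product, Finset.mem_powersetCard] at h
  obtain ⟨⟨hA, hAT⟩, hB, hBT⟩ := h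
  have hAB : Disjoint A B := Finset.disjoint_of_subset_left hA (Finset.disjoint_of_subset_right hB hXY)
  have h1 := binomialRandom_forall_notMem p ((A ×ˢ B).image fun ab => s(ab.1, ab.2)) (by
    intro e he
    obtain ⟨⟨a, b⟩, hab, rfl⟩ := Finset.mem_image.1 he
    obtain ⟨ha, hb⟩ := Finset.mem_product.1 hab
    rw [Sym2.mk_isDiag_iff]
    exact fun h => Finset.disjoint_left.1 hAB ha (h ▸ hb))
  rw [Finset.card_image_of_injOn, Finset.card_product, hAT, hBT] at h1
  · rw [← h1]
    refine le_of_eq ?_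
    congr 1
    ext G
    simp only [Set.mem_ofPred_eq, Finset.forall_mem_image, SimpleGraph.mem_edgeSet,
      Finset.mem_product, Prod.forall]
    exact ⟨fun h a b hab => h a hab.1 b hab.2, fun h a ha b hb => h a b ⟨ha, hb⟩⟩
  · rintro ⟨a, b⟩ hab ⟨a', b'⟩ hab' h
    simp only [Finset.coe_product, Set.mem_prod, SetLike.mem_coe] at hab hab'
    rcases Sym2.eq_iff.1 h with ⟨h1, h2⟩ | ⟨h1, h2⟩
    · exact Prod.ext h1 h2
    · have h1' : a = b' := h1
      exact absurd (h1' ▸ hab.1) fun h => Finset.disjoint_left.1 hAB h hab'.2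

end Probability

/-! ### Realisers and exceptional sets. -/

section Realiser

variable {V : Type*}

/-- Szpilrajn's theorem, applied to `P` with the relation `i ≤ j` added; `hij` is what keeps the
enlarged relation antisymmetric. -/
theorem exists_linear_extension (P : PartialOrder V) {i j : V} (hij : ¬ P.le j i) :
    ∃ L : V → V → Prop, IsStrictTotalOrder V L ∧ (∀ a b, P.lt a b → L a b) ∧
      (i ≠ j → L i j) := by
  let r : V → V → Prop := fun a b => P.le a b ∨ (P.le a i ∧ P.le j b)
  have hr : IsPartialOrder V r :=
    { refl := fun a => Or.inl (P.le_refl a)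
      trans := by
        rintro a b c (h | ⟨h1, h2⟩) (h' | ⟨h1', h2'⟩)
        · exact Or.inl (P.le_trans _ _ _ h h')
        · exact Or.inr ⟨P.le_trans _ _ _ h h1', h2'⟩
        · exact Or.inr ⟨h1, P.le_trans _ _ _ h2 h'⟩
        · exact Or.inr ⟨h1, h2'⟩
      antisymm := by
        rintro a b (h | ⟨h1, h2⟩) (h' | ⟨h1', h2'⟩)
        · exact P.le_antisymm _ _ h h'
        · exact absurd (P.le_trans _ _ _ h2' (P.le_trans _ _ _ h h1')) hij
        · exact absurd (P.le_trans _ _ _ h2 (P.le_trans _ _ _ h' h1)) hij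
        · exact absurd (P.le_trans _ _ _ h2 h1') hij }
  obtain ⟨s, hs, hrs⟩ := extend_partialOrder r
  refine ⟨fun a b => s a b ∧ a ≠ b, ?_, ?_, ?_⟩
  · exact
      { irrefl := fun a h => h.2 rfl
        trans := fun a b c h h' => ⟨hs.trans _ _ _ h.1 h'.1, by
          rintro rfl
          exact h.2 (hs.antisymm _ _ h.1 h'.1)⟩
        trichotomous := fun a b h h' => by
          by_contra hab
          rcases hs.total a b with h1 | h1
          · exact h ⟨h1, hab⟩
          · exact h' ⟨h1, Ne.symm hab⟩ }
  · intro a b h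
    refine ⟨hrs _ _ (Or.inl ((P.lt_iff_le_not_ge a b).1 h).1), ?_⟩
    rintro rfl
    exact ((P.lt_iff_le_not_ge a a).1 h).2 (P.le_refl a)
  · exact fun h => ⟨hrs _ _ (Or.inr ⟨P.le_refl i, P.le_refl j⟩), h⟩

theorem exists_isRealiser (P : PartialOrder V) : ∃ R, IsRealiser P R := by
  refine ⟨{L | IsStrictTotalOrder V L ∧ ∀ a b, P.lt a b → L a b}, fun L hL => hL.1,
    fun i j hij L hL => hL.2 i j hij, fun i j hij hji => ?_⟩
  have hne : i ≠ j := by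
    rintro rfl
    exact hij (P.le_refl i)
  obtain ⟨L, h1, h2, h3⟩ := exists_linear_extension P hji
  obtain ⟨L', h1', h2', h3'⟩ := exists_linear_extension P hij
  exact ⟨⟨L, ⟨h1, h2⟩, h3 hne⟩, L', ⟨h1', h2'⟩, h3' hne.symm⟩

/-- Since `sInf ∅ = 0` in `ℕ`, a lower bound on the dimension requires that some realiser exists. -/
theorem le_posetDim [Finite V] (P : PartialOrder V) {r : ℝ}
    (h : ∀ R, IsRealiser P R → r ≤ R.ncard) : r ≤ posetDim P := by
  obtain ⟨R, hR⟩ := exists_isRealiser P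
  have hne : (Set.ncard '' {R : Set (V → V → Prop) | IsRealiser P R}).Nonempty := ⟨_, R, hR, rfl⟩
  obtain ⟨R', hR', h'⟩ := Nat.sInf_mem hne
  rw [posetDim, ← h']
  exact h R' hR'

theorem two_le_posetDim [Finite V] (P : PartialOrder V) {i j : V} (hij : ¬ P.le i j)
    (hji : ¬ P.le j i) : (2 : ℝ) ≤ posetDim P := by
  refine le_posetDim P fun R hR => ?_
  obtain ⟨⟨L, hL, hLij⟩, L', hL', hLji⟩ := hR.reverses i j hij hji
  have hne : L ≠ L' := by
    rintro rfl
    have := hR.isStrictTotalOrder L hL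
    exact irrefl_of L i (trans_of L hLij hLji)
  have : 1 < R.ncard := (Set.one_lt_ncard (Set.toFinite R)).2 ⟨L, hL, L', hL', hne⟩
  exact_mod_cast this

/-- If any `b` elements of `X` and any `b` elements of `Y` contain a pair `x < y`, then a linear
extension puts all but at most `b` elements of `X` below all but at most `b` elements of `Y`. -/
theorem exists_small_exceptional_sets [LinearOrder V] (X Y : Finset V) {b : ℕ} (hb : 0 < b)
    (h : ∀ A ⊆ X, A.card = b → ∀ B ⊆ Y, B.card = b → ∃ x ∈ A, ∃ y ∈ B, x < y) :
    ∃ X₀ Y₀ : Finset V, X₀.card ≤ b ∧ Y₀.card ≤ b ∧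
      ∀ x ∈ X, x ∉ X₀ → ∀ y ∈ Y, y ∉ Y₀ → ¬ y < x := by
  let Y₀ := Y.filter fun y => b ≤ (X.filter (y < ·)).card
  let X₀ := X.filter fun x => ∃ y ∈ Y \ Y₀, y < x
  refine ⟨X₀, Y₀, ?_, ?_, ?_⟩
  · rcases (Y \ Y₀).eq_empty_or_nonempty with hY | hY
    · simp [X₀, hY]
    obtain ⟨y, hy, hmin⟩ := (Y \ Y₀).exists_min_image id hY
    -- The least `y` outside `Y₀` has every element of `X₀` above it, but fewer than `b` elements of
    -- `X` above it.
    have hy' : (X.filter (y < ·)).card < b := by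
      by_contra! hcon
      rw [Finset.mem_sdiff] at hy
      exact hy.2 (Finset.mem_filter.2 ⟨hy.1, hcon⟩)
    refine (Finset.card_le_card ?_).trans hy'.le
    intro x hx
    obtain ⟨hxX, z, hz, hzx⟩ := Finset.mem_filter.1 hx
    exact Finset.mem_filter.2 ⟨hxX, (hmin z hz).trans_lt hzx⟩
  -- Otherwise take `b` elements of `Y₀` and `b` elements of `X` above the greatest of them: no pair
  -- `x < z` is possible between these two sets.
  · by_contra! hcon
    obtain ⟨B, hB, hBb⟩ := Finset.exists_subset_card_eq hcon.le
    have hBne : B.Nonempty := Finset.card_pos.1 (hBb ▸ hb)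
    obtain ⟨y, hy, hmax⟩ := B.exists_max_image id hBne
    obtain ⟨A, hA, hAb⟩ := Finset.exists_subset_card_eq (Finset.mem_filter.1 (hB hy)).2
    obtain ⟨x, hx, z, hz, hxz⟩ := h A (hA.trans (Finset.filter_subset _ _)) hAb B
      (hB.trans (Finset.filter_subset _ _)) hBb
    have h2 : y < x := (Finset.mem_filter.1 (hA hx)).2
    have h3 : z ≤ y := hmax z hz
    exact lt_irrefl _ (hxz.trans_le (h3.trans h2.le))
  · intro x hx hx0 y hy hy0 hyx
    exact hx0 (Finset.mem_filter.2 ⟨hx, y, Finset.mem_sdiff.2 ⟨hy, hy0⟩, hyx⟩)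

open Classical in
theorem IsRealiser.card_lt [Finite V] {P : PartialOrder V} {R : Set (V → V → Prop)}
    (hR : IsRealiser P R) (X Y : Finset V) {b m : ℕ} (hb : 0 < b) (hXY : X.card = Y.card)
    (hYX : ∀ x ∈ X, ∀ y ∈ Y, ¬ P.le y x)
    (h : ∀ A ⊆ X, A.card = b → ∀ B ⊆ Y, B.card = b → ∃ x ∈ A, ∃ y ∈ B, P.lt x y)
    (hup : ∀ x ∈ X, (Y.filter (P.le x)).card < m) (hm : 0 < m) :
    X.card < R.ncard * b + m := by
  by_contra! hcon
  have hex : ∀ L : V → V → Prop, ∃ X₀ Y₀ : Finset V, X₀.card ≤ b ∧ Y₀.card ≤ b ∧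
      (L ∈ R → ∀ x ∈ X, x ∉ X₀ → ∀ y ∈ Y, y ∉ Y₀ → ¬ L y x) := by
    intro L
    by_cases hL : L ∈ R
    · have := hR.isStrictTotalOrder L hL
      obtain ⟨X₀, Y₀, h1, h2, h3⟩ := @exists_small_exceptional_sets V (linearOrderOfSTO L) X Y b hb
        fun A hA hAb B hB hBb => by
          obtain ⟨x, hx, y, hy, hxy⟩ := h A hA hAb B hB hBb
          exact ⟨x, hx, y, hy, hR.extends_lt x y hxy L hL⟩
      exact ⟨X₀, Y₀, h1, h2, fun _ => h3⟩
    · exact ⟨∅, ∅, by simp, by simp, fun h => absurd h hL⟩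
  choose X₀ Y₀ hX₀ hY₀ hL using hex
  let R' := (Set.toFinite R).toFinset
  have hR' : R'.card = R.ncard := (Set.ncard_eq_toFinset_card R).symm
  have hle : ∀ x ∈ X, x ∉ R'.biUnion X₀ → ∀ y ∈ Y, y ∉ R'.biUnion Y₀ → P.le x y := by
    intro x hx hx' y hy hy'
    by_contra hxy
    obtain ⟨-, L, hLR, hLyx⟩ := hR.reverses x y hxy (hYX x hx y hy)
    have hLR' : L ∈ R' := (Set.Finite.mem_toFinset _).2 hLR
    exact hL L hLR x hx (fun h => hx' (Finset.mem_biUnion.2 ⟨L, hLR', h⟩)) y hy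
      (fun h => hy' (Finset.mem_biUnion.2 ⟨L, hLR', h⟩)) hLyx
  have hcX : (R'.biUnion X₀).card ≤ R.ncard * b :=
    hR' ▸ Finset.card_biUnion_le_card_mul R' X₀ b fun L _ => hX₀ L
  have hcY : (R'.biUnion Y₀).card ≤ R.ncard * b :=
    hR' ▸ Finset.card_biUnion_le_card_mul R' Y₀ b fun L _ => hY₀ L
  have hex : (X \ R'.biUnion X₀).Nonempty := by
    rw [← Finset.card_pos]
    have := Finset.le_card_sdiff (R'.biUnion X₀) X
    omega
  obtain ⟨x, hx⟩ := hex
  rw [Finset.mem_sdiff] at hx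
  -- The left side has at least `k - |R| b ≥ m` elements, where `k` is the common size of `X` and
  -- `Y`, while `hup` allows fewer than `m` on the right.
  have h1 : Y \ R'.biUnion Y₀ ⊆ Y.filter (P.le x) := by
    intro y hy
    rw [Finset.mem_sdiff] at hy
    exact Finset.mem_filter.2 ⟨hy.1, hle x hx.1 hx.2 y hy.1 hy.2⟩
  have h2 := Finset.card_le_card h1
  have h3 := Finset.le_card_sdiff (R'.biUnion Y₀) Y
  have h4 := hup x hx.1
  omega

end Realiser

/-! ### Exploration in the graph order. -/

section Graph

theorem IsReached.exists_rel {V : Type*} {G : SimpleGraph V} {w : ℕ → V} {M : ℕ} {A : Finset V}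
    {S : Finset ℕ} (hS : IsReached G w M A S) (r : V → V → Prop)
    (hr : ∀ a b c, r a b → r b c → r a c)
    (hA : ∀ a ∈ A, ∀ j < M, G.Adj a (w j) → r a (w j))
    (hw : ∀ i j, i < j → j < M → G.Adj (w i) (w j) → r (w i) (w j)) :
    ∀ j ∈ S, ∃ a ∈ A, r a (w j) := by
  intro j
  induction j using Nat.strong_induction_on with
  | _ j ih =>
    intro hj
    have hjM := Finset.mem_range.1 (hS.1 hj)
    rcases (hS.2 j hjM).1 hj with ⟨a, ha, h⟩ | ⟨i, hi, hij, h⟩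
    · exact ⟨a, ha, hA a ha j hjM h⟩
    · obtain ⟨a, ha, hai⟩ := ih i hij hi
      exact ⟨a, ha, hr _ _ _ hai (hw i j hij hjM h)⟩

theorem le_of_graphOrder_le {V : Type*} [LinearOrder V] {G : SimpleGraph V} {a b : V}
    (h : (graphOrder G).le a b) : a ≤ b := by
  induction h with
  | refl => exact le_rfl
  | tail _ hbc ih => exact ih.trans hbc.1.le

theorem graphOrder_le_of_adj {V : Type*} [LinearOrder V] {G : SimpleGraph V} {a b : V}
    (hab : a < b) (h : G.Adj a b) : (graphOrder G).le a b :=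
  Relation.ReflTransGen.single ⟨hab, h⟩

theorem val_ofNat_of_lt {n : ℕ} [NeZero n] {i : ℕ} (h : i < n) : (Fin.ofNat n i).val = i := by
  simp [Fin.ofNat, Nat.mod_eq_of_lt h]

theorem injOn_ofNat (n : ℕ) [NeZero n] : Set.InjOn (Fin.ofNat n) (Set.Iio n) := by
  intro i hi j hj h
  rw [← val_ofNat_of_lt hi, ← val_ofNat_of_lt hj, h]

open Classical in
-- The pool consists of all vertices after `x` in increasing order, so an increasing path from `x`
-- is followed vertex by vertex by the exploration.
theorem IsReached.card_up_le {n : ℕ} [NeZero n] {G : SimpleGraph (Fin n)} {x : Fin n}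
    {S : Finset ℕ}
    (hS : IsReached G (fun j => Fin.ofNat n (x.val + 1 + j)) (n - 1 - x.val) {x} S)
    (Y : Finset (Fin n)) (hx : x ∉ Y) :
    (Y.filter ((graphOrder G).le x)).card ≤ S.card := by
  have key : ∀ y, (graphOrder G).le x y →
      y = x ∨ ∃ j ∈ S, y = Fin.ofNat n (x.val + 1 + j) := by
    intro y hy
    induction hy with
    | refl => exact Or.inl rfl
    | @tail v y hv hvy ih =>
      right
      have hxv : x ≤ v := le_of_graphOrder_le hv
      have hvy' : v.val < y.val := hvy.1
      have hxv' : x.val ≤ v.val := hxv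
      have hy := y.isLt
      have hyw : y = Fin.ofNat n (x.val + 1 + (y.val - 1 - x.val)) := by
        apply Fin.ext
        rw [val_ofNat_of_lt (by omega)]
        omega
      refine ⟨y.val - 1 - x.val, (hS.2 _ (by omega)).2 ?_, hyw⟩
      rcases ih with rfl | ⟨i, hi, hvi⟩
      · exact Or.inl ⟨v, by simp, by beta_reduce; rw [← hyw]; exact hvy.2⟩
      · refine Or.inr ⟨i, hi, ?_, ?_⟩
        · have hiM := Finset.mem_range.1 (hS.1 hi)
          have h2 := congrArg Fin.val hvi
          rw [val_ofNat_of_lt (by omega)] at h2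
          omega
        · beta_reduce
          rw [← hyw, ← hvi]
          exact hvy.2
  refine (Finset.card_le_card (t := S.image fun j => Fin.ofNat n (x.val + 1 + j)) ?_).trans
    Finset.card_image_le
  intro y hy
  obtain ⟨hyY, hxy⟩ := Finset.mem_filter.1 hy
  rcases key y hxy with rfl | ⟨j, hj, h⟩
  · exact absurd hyY hx
  · exact Finset.mem_image.2 ⟨j, hj, h.symm⟩

/-- The vertices counted from the top. -/
def revNat (n : ℕ) [NeZero n] (i : ℕ) : Fin n := (Fin.ofNat n i).rev

theorem val_revNat_of_lt {n : ℕ} [NeZero n] {i : ℕ} (h : i < n) :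
    (revNat n i).val = n - 1 - i := by
  rw [revNat, Fin.val_rev, val_ofNat_of_lt h]
  omega

theorem injOn_revNat (n : ℕ) [NeZero n] : Set.InjOn (revNat n) (Set.Iio n) :=
  fun _ hi _ hj h => injOn_ofNat n hi hj (Fin.rev_injective h)

theorem card_image_of_le {n : ℕ} {e : ℕ → Fin n} (he : Set.InjOn e (Set.Iio n)) {k : ℕ}
    (hk : k ≤ n) : ((Finset.range k).image e).card = k := by
  rw [Finset.card_image_of_injOn, Finset.card_range]
  exact he.mono fun i hi => (Finset.mem_range.1 hi).trans_le hk

theorem card_lt_of_isRealiser_graphOrder {n : ℕ} [NeZero n] {k h b T m : ℕ}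
    (hkh : k ≤ h) (hhn : 2 * h ≤ n) (hb : 0 < b) (hm : 0 < m) (G : SimpleGraph (Fin n))
    (hlow : ∀ A ⊆ (Finset.range k).image (Fin.ofNat n), A.card = b →
      ∀ S, IsReached G (fun j => Fin.ofNat n (k + j)) (h - k) A S → T ≤ S.card)
    (hhigh : ∀ A ⊆ (Finset.range k).image (revNat n), A.card = b →
      ∀ S, IsReached G (fun j => revNat n (k + j)) (h - k) A S → T ≤ S.card)
    (hedge : ∀ A ⊆ (Finset.range h).image (Fin.ofNat n), A.card = T →
      ∀ B ⊆ (Finset.range h).image (revNat n), B.card = T → ∃ u ∈ A, ∃ v ∈ B, G.Adj u v)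
    (hup : ∀ x : Fin n, ∀ S, IsReached G (fun j => Fin.ofNat n (x.val + 1 + j))
      (n - 1 - x.val) {x} S → S.card < m)
    {R : Set (Fin n → Fin n → Prop)} (hR : IsRealiser (graphOrder G) R) :
    k < R.ncard * b + m := by
  classical
  set X := (Finset.range k).image (Fin.ofNat n) with hX
  set Y := (Finset.range k).image (revNat n) with hY
  have hXval : ∀ x ∈ X, x.val < k := by
    intro x hx
    obtain ⟨i, hi, rfl⟩ := Finset.mem_image.1 hx
    have := Finset.mem_range.1 hi
    rwa [val_ofNat_of_lt (by omega)]
  have hYval : ∀ y ∈ Y, n - k ≤ y.val := by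
    intro y hy
    obtain ⟨i, hi, rfl⟩ := Finset.mem_image.1 hy
    have := Finset.mem_range.1 hi
    rw [val_revNat_of_lt (by omega)]
    omega
  have hXc : X.card = k := card_image_of_le (injOn_ofNat n) (by omega)
  have hYc : Y.card = k := card_image_of_le (injOn_revNat n) (by omega)
  have hYX : ∀ x ∈ X, ∀ y ∈ Y, ¬ (graphOrder G).le y x := by
    intro x hx y hy hyx
    have h1 : y.val ≤ x.val := Fin.le_def.1 (le_of_graphOrder_le hyx)
    clear hyx
    have := hXval x hx
    have := hYval y hy
    omega
  have hmain := hR.card_lt X Y (m := m) hb (hXc.trans hYc.symm) hYX ?_ ?_ hm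
  · rwa [hXc] at hmain
  · intro A hA hAb B hB hBb
    obtain ⟨S, hS⟩ := exists_isReached G (fun j => Fin.ofNat n (k + j)) (h - k) A
    obtain ⟨S', hS'⟩ := exists_isReached G (fun j => revNat n (k + j)) (h - k) B
    obtain ⟨S₁, hS₁, hc₁⟩ := Finset.exists_subset_card_eq (hlow A hA hAb S hS)
    obtain ⟨S₂, hS₂, hc₂⟩ := Finset.exists_subset_card_eq (hhigh B hB hBb S' hS')
    have hlt : ∀ j ∈ S, k + j < h := fun j hj => by
      have := Finset.mem_range.1 (hS.1 hj)
      omega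
    have hlt' : ∀ j ∈ S', k + j < h := fun j hj => by
      have := Finset.mem_range.1 (hS'.1 hj)
      omega
    obtain ⟨u, hu, v, hv, huv⟩ := hedge (S₁.image fun j => Fin.ofNat n (k + j))
      (by
        intro u hu
        obtain ⟨j, hj, rfl⟩ := Finset.mem_image.1 hu
        exact Finset.mem_image.2 ⟨k + j, Finset.mem_range.2 (hlt j (hS₁ hj)), rfl⟩)
      (by
        rw [Finset.card_image_of_injOn, hc₁]
        intro i hi j hj hij
        have h1 := hlt i (hS₁ hi)
        have h2 := hlt j (hS₁ hj)
        have := injOn_ofNat n (show k + i < n by omega) (show k + j < n by omega) hij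
        omega)
      (S₂.image fun j => revNat n (k + j))
      (by
        intro u hu
        obtain ⟨j, hj, rfl⟩ := Finset.mem_image.1 hu
        exact Finset.mem_image.2 ⟨k + j, Finset.mem_range.2 (hlt' j (hS₂ hj)), rfl⟩)
      (by
        rw [Finset.card_image_of_injOn, hc₂]
        intro i hi j hj hij
        have h1 := hlt' i (hS₂ hi)
        have h2 := hlt' j (hS₂ hj)
        have := injOn_revNat n (show k + i < n by omega) (show k + j < n by omega) hij
        omega)
    obtain ⟨i, hi, rfl⟩ := Finset.mem_image.1 hu
    obtain ⟨j, hj, rfl⟩ := Finset.mem_image.1 hv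
    have hi' := hlt i (hS₁ hi)
    have hj' := hlt' j (hS₂ hj)
    obtain ⟨a, ha, hau⟩ := hS.exists_rel (graphOrder G).le (graphOrder G).le_trans
      (by
        intro a ha j hj hadj
        refine graphOrder_le_of_adj (Fin.lt_def.2 ?_) hadj
        have := hXval a (hA ha)
        rw [val_ofNat_of_lt (by omega)]
        omega)
      (by
        intro i j hij hj hadj
        refine graphOrder_le_of_adj (Fin.lt_def.2 ?_) hadj
        rw [val_ofNat_of_lt (by omega), val_ofNat_of_lt (by omega)]
        omega) i (hS₁ hi)
    obtain ⟨c, hc, hcv⟩ := hS'.exists_rel (fun x y => (graphOrder G).le y x)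
      (fun x y z hxy hyz => (graphOrder G).le_trans _ _ _ hyz hxy)
      (by
        intro a ha j hj hadj
        refine graphOrder_le_of_adj (Fin.lt_def.2 ?_) hadj.symm
        have := hYval a (hB ha)
        rw [val_revNat_of_lt (by omega)]
        omega)
      (by
        intro i j hij hj hadj
        refine graphOrder_le_of_adj (Fin.lt_def.2 ?_) hadj.symm
        rw [val_revNat_of_lt (by omega), val_revNat_of_lt (by omega)]
        omega) j (hS₂ hj)
    -- The edge points upwards because `2h ≤ n` separates the two halves; it joins the chain from
    -- `a` up to `u` with the chain from `v` up to `c`.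
    have huv' : (graphOrder G).le (Fin.ofNat n (k + i)) (revNat n (k + j)) := by
      refine graphOrder_le_of_adj (Fin.lt_def.2 ?_) huv
      rw [val_ofNat_of_lt (by omega), val_revNat_of_lt (by omega)]
      omega
    exact ⟨a, ha, c, hc, (graphOrder G).le_trans _ _ _ hau ((graphOrder G).le_trans _ _ _ huv' hcv),
      hYX a (hA ha) c (hB hc)⟩
  · intro x hx
    obtain ⟨S, hS⟩ := exists_isReached G (fun j => Fin.ofNat n (x.val + 1 + j)) (n - 1 - x.val) {x}
    have hxY : x ∉ Y := fun h => hYX x hx x h Relation.ReflTransGen.refl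
    refine lt_of_le_of_lt ?_ (hup x S hS)
    convert hS.card_up_le Y hxY

end Graph

/-! ### The union bound for finite `n`. -/

/-- Non-asymptotic form of the lower bound: the probability that the random graph order has a
realiser with too few elements. -/
theorem binomialRandom_exists_isRealiser_le {n : ℕ} [NeZero n] {k h b T m : ℕ}
    (hkh : k ≤ h) (hhn : 2 * h ≤ n) (hb : 0 < b) (hm : 0 < m) (p : unitInterval)
    (hp0 : (0 : ℝ) < p) (hp1 : (p : ℝ) < 1) :
    (SimpleGraph.binomialRandom (Fin n) p).real
        {G | ∃ R, IsRealiser (graphOrder G) R ∧ R.ncard * b + m ≤ k} ≤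
      2 * ∑ t ∈ Finset.range T, k.choose b * reachProb (1 - p) b (h - k) t +
        h.choose T * h.choose T * (1 - p : ℝ) ^ (T * T) +
        n ^ 2 * (1 - (1 - p : ℝ) ^ n) ^ m := by
  classical
  set μ := SimpleGraph.binomialRandom (Fin n) p
  let X := (Finset.range k).image (Fin.ofNat n)
  let Y := (Finset.range k).image (revNat n)
  let X' := (Finset.range h).image (Fin.ofNat n)
  let Y' := (Finset.range h).image (revNat n)
  have hq0 : (0 : ℝ) < 1 - p := by linarith
  have hq1 : (1 - p : ℝ) < 1 := by linarith
  -- The four kinds of bad event: a `b`-set in `X` or in `Y` reaching fewer than `T` vertices, two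
  -- `T`-sets in opposite halves without an edge, and a vertex `x` reaching at least `m` vertices
  -- upwards.
  let B₁ : Set (SimpleGraph (Fin n)) := {G | ∃ A ⊆ X, A.card = b ∧
    ∃ S : Finset ℕ, S.card ∈ Finset.range T ∧ IsReached G (fun j => Fin.ofNat n (k + j)) (h - k) A S}
  let B₂ : Set (SimpleGraph (Fin n)) := {G | ∃ A ⊆ Y, A.card = b ∧
    ∃ S : Finset ℕ, S.card ∈ Finset.range T ∧ IsReached G (fun j => revNat n (k + j)) (h - k) A S}
  let B₃ : Set (SimpleGraph (Fin n)) := {G | ∃ A ⊆ X', A.card = T ∧ ∃ B ⊆ Y', B.card = T ∧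
    ∀ u ∈ A, ∀ v ∈ B, ¬ G.Adj u v}
  let B₄ : Fin n → Set (SimpleGraph (Fin n)) := fun x => {G | ∃ A ⊆ {x}, A.card = 1 ∧
    ∃ S : Finset ℕ, S.card ∈ Finset.Ico m n ∧
      IsReached G (fun j => Fin.ofNat n (x.val + 1 + j)) (n - 1 - x.val) A S}
  have hinj : ∀ {e : ℕ → Fin n}, Set.InjOn e (Set.Iio n) → ∀ i M, i + M ≤ n →
      Set.InjOn (fun j => e (i + j)) (Set.Iio M) := by
    intro e he i M hiM j hj j' hj' hjj
    have hj0 : j < M := hj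
    have hj0' : j' < M := hj'
    have := he (show i + j < n by omega) (show i + j' < n by omega) hjj
    omega
  have hdisj : ∀ {e : ℕ → Fin n}, Set.InjOn e (Set.Iio n) →
      ∀ j < h - k, e (k + j) ∉ (Finset.range k).image e := by
    intro e he j hj hmem
    obtain ⟨i, hi, hij⟩ := Finset.mem_image.1 hmem
    have hi' := Finset.mem_range.1 hi
    have := he (show i < n by omega) (show k + j < n by omega) hij
    omega
  have h1 : μ.real B₁ ≤ ∑ t ∈ Finset.range T, k.choose b * reachProb (1 - p) b (h - k) t := by
    have := binomialRandom_exists_isReached_le p (fun j => Fin.ofNat n (k + j)) (h - k) X b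
      (Finset.range T) (hinj (injOn_ofNat n) k (h - k) (by omega)) (hdisj (injOn_ofNat n))
    rwa [card_image_of_le (injOn_ofNat n) (by omega), Finset.mul_sum] at this
  have h2 : μ.real B₂ ≤ ∑ t ∈ Finset.range T, k.choose b * reachProb (1 - p) b (h - k) t := by
    have := binomialRandom_exists_isReached_le p (fun j => revNat n (k + j)) (h - k) Y b
      (Finset.range T) (hinj (injOn_revNat n) k (h - k) (by omega)) (hdisj (injOn_revNat n))
    rwa [card_image_of_le (injOn_revNat n) (by omega), Finset.mul_sum] at this
  have h3 : μ.real B₃ ≤ h.choose T * h.choose T * (1 - p : ℝ) ^ (T * T) := by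
    have := binomialRandom_exists_no_edge_le p X' Y' (by
      rw [Finset.disjoint_left]
      intro u hu hu'
      obtain ⟨i, hi, rfl⟩ := Finset.mem_image.1 hu
      obtain ⟨j, hj, hij⟩ := Finset.mem_image.1 hu'
      have hi' := Finset.mem_range.1 hi
      have hj' := Finset.mem_range.1 hj
      have := congrArg Fin.val hij
      rw [val_ofNat_of_lt (by omega), val_revNat_of_lt (by omega)] at this
      omega) T
    rwa [card_image_of_le (injOn_ofNat n) (by omega), card_image_of_le (injOn_revNat n) (by omega)]
      at this
  have hqn : (0 : ℝ) ≤ 1 - (1 - p : ℝ) ^ n := sub_nonneg.2 (pow_le_one₀ hq0.le hq1.le)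
  have hqn1 : 1 - (1 - p : ℝ) ^ n ≤ 1 := by linarith [pow_pos hq0 n]
  have h4 : ∀ x, μ.real (B₄ x) ≤ n * (1 - (1 - p : ℝ) ^ n) ^ m := by
    intro x
    have := binomialRandom_exists_isReached_le p (fun j => Fin.ofNat n (x.val + 1 + j))
      (n - 1 - x.val) {x} 1 (Finset.Ico m n)
      (hinj (injOn_ofNat n) (x.val + 1) (n - 1 - x.val) (by omega)) (by
        intro j hj hmem
        have := congrArg Fin.val (Finset.mem_singleton.1 hmem)
        rw [val_ofNat_of_lt (by omega)] at this
        omega)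
    refine this.trans ?_
    rw [Finset.card_singleton, Nat.choose_self, Nat.cast_one, one_mul]
    refine (Finset.sum_le_card_nsmul _ _ ((1 - (1 - p : ℝ) ^ n) ^ m) ?_).trans ?_
    · intro t ht
      have hmt := (Finset.mem_Ico.1 ht).1
      refine (reachProb_one_le hq0 hq1 _ t).trans ?_
      refine (pow_le_pow_left₀ (sub_nonneg.2 (pow_le_one₀ hq0.le hq1.le)) (sub_le_sub_left
        (pow_le_pow_of_le_one hq0.le hq1.le (show n - 1 - x.val ≤ n by omega)) 1) t).trans ?_
      exact pow_le_pow_of_le_one hqn hqn1 hmt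
    · rw [nsmul_eq_mul, Nat.card_Ico]
      have : ((n - m : ℕ) : ℝ) ≤ n := by exact_mod_cast Nat.sub_le n m
      gcongr
  have hsub : {G | ∃ R, IsRealiser (graphOrder G) R ∧ R.ncard * b + m ≤ k} ⊆
      ((B₁ ∪ B₂) ∪ B₃) ∪ ⋃ x ∈ Finset.univ, B₄ x := by
    rintro G ⟨R, hR, hle⟩
    by_contra hG
    simp only [Set.mem_union, not_or, Set.mem_iUnion, Finset.mem_univ, exists_prop, true_and,
      not_exists] at hG
    obtain ⟨⟨⟨hG₁, hG₂⟩, hG₃⟩, hG₄⟩ := hG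
    refine absurd (card_lt_of_isRealiser_graphOrder (T := T) (m := m) hkh hhn hb hm G
      ?_ ?_ ?_ ?_ hR) (not_lt.2 hle)
    · intro A hA hAb S hS
      by_contra! hcon
      exact hG₁ ⟨A, hA, hAb, S, Finset.mem_range.2 hcon, hS⟩
    · intro A hA hAb S hS
      by_contra! hcon
      exact hG₂ ⟨A, hA, hAb, S, Finset.mem_range.2 hcon, hS⟩
    · intro A hA hAT B hB hBT
      by_contra! hcon
      exact hG₃ ⟨A, hA, hAT, B, hB, hBT, hcon⟩
    · intro x S hS
      by_contra! hcon
      refine hG₄ x ⟨{x}, subset_rfl, by simp, S, Finset.mem_Ico.2 ⟨hcon, ?_⟩, hS⟩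
      have := Finset.card_le_card hS.1
      rw [Finset.card_range] at this
      have := x.isLt
      omega
  calc μ.real {G | ∃ R, IsRealiser (graphOrder G) R ∧ R.ncard * b + m ≤ k}
      ≤ μ.real (((B₁ ∪ B₂) ∪ B₃) ∪ ⋃ x ∈ Finset.univ, B₄ x) :=
        measureReal_mono hsub (measure_ne_top _ _)
    _ ≤ ((μ.real B₁ + μ.real B₂) + μ.real B₃) + ∑ x, μ.real (B₄ x) := by
        refine (measureReal_union_le _ _).trans (add_le_add ?_ (measureReal_biUnion_finset_le _ _))
        exact (measureReal_union_le _ _).trans (add_le_add_left (measureReal_union_le _ _) _)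
    _ ≤ _ := by
        have h5 := Finset.sum_le_card_nsmul Finset.univ (fun x => μ.real (B₄ x)) _ fun x _ => h4 x
        rw [Finset.card_univ, Fintype.card_fin, nsmul_eq_mul, ← mul_assoc, ← sq] at h5
        linarith

/-! ### Asymptotics for part (a). -/

/-- The function `f` with independent parameters for the sizes of the starting set, of the pool and
of the chosen subset. -/
noncomputable def exponent (z : ℝ × ℝ × ℝ × ℝ × ℝ) (t : ℝ) : ℝ :=
  z.2.2.1 * Real.log (Real.exp 1 * z.2.1 / z.2.2.1) - z.1 * z.2.2.1 * (z.2.2.2.1 - t)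
    + 1 / z.1 * (Li2 1 - Li2 (Real.exp (-(z.1 * t))))
    + 1 / z.1 * (Li2 (Real.exp (-(z.1 * z.2.2.1) - z.1 * t)) - Li2 (Real.exp (-(z.1 * z.2.2.1)))
        + Li2 (Real.exp (-(z.1 * (z.2.2.2.2 - t)) - z.1 * t))
        - Li2 (Real.exp (-(z.1 * (z.2.2.2.2 - t)))))

theorem continuousAt_exponent {z : ℝ × ℝ × ℝ × ℝ × ℝ} (t : ℝ) (h1 : z.1 ≠ 0) (h2 : z.2.1 ≠ 0)
    (h3 : z.2.2.1 ≠ 0) :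
    ContinuousAt (fun zt : (ℝ × ℝ × ℝ × ℝ × ℝ) × ℝ => exponent zt.1 zt.2) (z, t) := by
  have hL : ∀ g : (ℝ × ℝ × ℝ × ℝ × ℝ) × ℝ → ℝ, Continuous g →
      ContinuousAt (fun zt => Li2 (Real.exp (g zt))) (z, t) :=
    fun g hg => (continuous_Li2.comp (Real.continuous_exp.comp hg)).continuousAt
  have hc : ContinuousAt (fun zt : (ℝ × ℝ × ℝ × ℝ × ℝ) × ℝ => 1 / zt.1.1) (z, t) :=
    ContinuousAt.div continuousAt_const (by fun_prop) h1
  unfold exponent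
  refine ((ContinuousAt.sub (ContinuousAt.mul (by fun_prop) ?_) (by fun_prop)).add
    (hc.mul (continuousAt_const.sub (hL _ (by fun_prop))))).add
    (hc.mul ((((hL _ (by fun_prop)).sub (hL _ (by fun_prop))).add (hL _ (by fun_prop))).sub
      (hL _ (by fun_prop))))
  refine ContinuousAt.log (ContinuousAt.div (by fun_prop) (by fun_prop) h3) ?_
  exact div_ne_zero (mul_ne_zero (Real.exp_ne_zero 1) h2) h3

/-- `f` is `exponent` at the limiting parameters. Joint continuity and compactness of `[0, a]` carry
a negative bound, uniform in `t`, to nearby parameters, so that the roundings at finite `n` do no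
harm. -/
theorem eventually_exponent_lt {c ξ β a : ℝ} (hc : 0 < c) (hξ : 0 < ξ) (hβ : 0 < β)
    (hf : sSup ((fun t => f c ξ β t) '' Set.Icc 0 a) < 0) :
    ∃ δ > 0, ∀ᶠ z in 𝓝 (c, ξ, β, 1 / 2 - ξ, 1 / 2 - ξ), ∀ t ∈ Set.Icc 0 a,
      exponent z t < -δ := by
  set z₀ : ℝ × ℝ × ℝ × ℝ × ℝ := (c, ξ, β, 1 / 2 - ξ, 1 / 2 - ξ) with hz₀
  have hcont : ∀ t, ContinuousAt (fun zt : (ℝ × ℝ × ℝ × ℝ × ℝ) × ℝ => exponent zt.1 zt.2) (z₀, t) :=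
    fun t => continuousAt_exponent t hc.ne' hξ.ne' hβ.ne'
  have hcont' : Continuous fun t => f c ξ β t := by
    refine continuous_iff_continuousAt.2 fun t => ?_
    have := (hcont t).comp (f := fun t : ℝ => (z₀, t)) (by fun_prop)
    exact this
  have hbdd : BddAbove ((fun t => f c ξ β t) '' Set.Icc 0 a) :=
    (isCompact_Icc.image hcont').bddAbove
  refine ⟨-sSup ((fun t => f c ξ β t) '' Set.Icc 0 a) / 2, by linarith, ?_⟩
  refine isCompact_Icc.eventually_forall_of_forall_eventually fun t ht => ?_
  have h1 : exponent z₀ t ≤ sSup ((fun t => f c ξ β t) '' Set.Icc 0 a) :=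
    le_csSup hbdd ⟨t, ht, rfl⟩
  exact (hcont t).eventually_lt_const (by linarith)

theorem choose_mul_reachProb_le {l : ℝ} (hl : 0 < l) {n k b : ℕ} (hn : 0 < n) (hk : 0 < k)
    (hb : 0 < b) (M t : ℕ) :
    (k.choose b : ℝ) * reachProb (Real.exp (-l)) b M t ≤
      Real.exp (n * exponent (n * l, (k / n : ℝ), (b / n : ℝ), (M / n : ℝ), ((M + 1) / n : ℝ))
        (t / n)) := by
  rcases lt_or_ge M t with h | h
  · rw [reachProb_eq_zero _ b h, mul_zero]
    exact (Real.exp_pos _).le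
  obtain ⟨m, rfl⟩ := Nat.exists_eq_add_of_le' h
  refine (mul_le_mul_of_nonneg_left (reachProb_le_exp hl hb m t) (Nat.cast_nonneg _)).trans ?_
  refine (mul_le_mul_of_nonneg_right (choose_le_exp hk hb) (Real.exp_pos _).le).trans_eq ?_
  have hn' : (n : ℝ) ≠ 0 := by positivity
  have hb' : (b : ℝ) ≠ 0 := by positivity
  rw [← Real.exp_add]
  congr 1
  simp only [exponent]
  have e1 : Real.exp 1 * (k / n : ℝ) / (b / n : ℝ) = Real.exp 1 * k / b := by
    field_simp
  have e2 : (n * l : ℝ) * (t / n) = l * t := by field_simp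
  have e3 : (n * l : ℝ) * (b / n) = l * b := by field_simp
  have e4 : (n * l : ℝ) * (((m + t : ℕ) + 1) / n - t / n) = l * (m + 1) := by
    push_cast
    field_simp
    ring
  rw [e1, e2, e3, e4, show -(l * b) - l * t = -(l * (b + t)) by ring,
    show -(l * ((m : ℝ) + 1)) - l * t = -(l * (m + 1 + t)) by ring]
  push_cast
  field_simp
  ring

theorem tendsto_floor_div {a : ℝ} (ha : 0 ≤ a) :
    Tendsto (fun n : ℕ => (⌊a * n⌋₊ : ℝ) / n) atTop (𝓝 a) :=
  (tendsto_nat_floor_mul_div_atTop ha).comp tendsto_natCast_atTop_atTop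

/-- With `l = -log (1 - c/n)` one has `e^(-l) = 1 - c/n` exactly, so the first parameter of
`exponent` is `nl`, which tends to `c`. -/
theorem tendsto_mul_neg_log_one_sub_div (c : ℝ) :
    Tendsto (fun n : ℕ => (n : ℝ) * -Real.log (1 - c / n)) atTop (𝓝 c) := by
  have h := ((Real.tendsto_mul_log_one_add_div_atTop (-c)).comp tendsto_natCast_atTop_atTop).neg
  rw [neg_neg] at h
  refine h.congr fun n => ?_
  simp only [Function.comp]
  rw [neg_div, ← sub_eq_add_neg, mul_neg]

theorem edgeProb_eq {c : ℝ} (hc : 0 < c) {n : ℕ} (hn : c < n) :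
    (edgeProb c n : ℝ) = c / n := by
  have hn0 : (0 : ℝ) < n := hc.trans hn
  rw [edgeProb, Set.projIcc_of_mem zero_le_one (x := c / n)
    ⟨by positivity, (div_le_one hn0).2 hn.le⟩]

theorem exp_neg_neg_log_one_sub_div {c : ℝ} (hc : 0 < c) {n : ℕ} (hn : c < n) :
    Real.exp (-(-Real.log (1 - c / n))) = 1 - c / n := by
  have hn0 : (0 : ℝ) < n := hc.trans hn
  rw [neg_neg, Real.exp_log]
  have := (div_lt_one hn0).2 hn
  linarith

theorem tendsto_pow_mul_exp_neg_nat (j : ℕ) {δ : ℝ} (hδ : 0 < δ) :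
    Tendsto (fun n : ℕ => (n : ℝ) ^ j * Real.exp (-(δ * n))) atTop (𝓝 0) := by
  have h := (Real.tendsto_pow_mul_exp_neg_atTop_nhds_zero j).comp
    (tendsto_natCast_atTop_atTop.const_mul_atTop hδ)
  have h2 := h.const_mul ((δ ^ j)⁻¹)
  rw [mul_zero] at h2
  refine h2.congr fun n => ?_
  simp only [Function.comp, mul_pow]
  field_simp

theorem eventually_cast_lt (c : ℝ) : ∀ᶠ n : ℕ in atTop, c < n :=
  tendsto_natCast_atTop_atTop.eventually_gt_atTop c

theorem tendsto_sum_choose_mul_reachProb {c ξ β a : ℝ} (hc : 0 < c) (hξ : 0 < ξ)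
    (hξ2 : ξ < 1 / 2) (hβ : 0 < β) (ha : 0 < a)
    (hf : sSup ((fun t => f c ξ β t) '' Set.Icc 0 a) < 0) :
    Tendsto (fun n : ℕ => ∑ t ∈ Finset.range ⌊a * n⌋₊, (⌊ξ * n⌋₊.choose ⌊β * n⌋₊ : ℝ) *
      reachProb (1 - c / n) ⌊β * n⌋₊ (⌊(1 / 2 : ℝ) * n⌋₊ - ⌊ξ * n⌋₊) t) atTop (𝓝 0) := by
  obtain ⟨δ, hδ, hev⟩ := eventually_exponent_lt hc hξ hβ hf
  have hkh : ∀ n : ℕ, ⌊ξ * n⌋₊ ≤ ⌊(1 / 2 : ℝ) * n⌋₊ := fun n =>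
    Nat.floor_mono (mul_le_mul_of_nonneg_right hξ2.le (Nat.cast_nonneg n))
  have hM : Tendsto (fun n : ℕ => ((⌊(1 / 2 : ℝ) * n⌋₊ - ⌊ξ * n⌋₊ : ℕ) : ℝ) / n) atTop
      (𝓝 (1 / 2 - ξ)) := by
    refine ((tendsto_floor_div (by norm_num : (0 : ℝ) ≤ 1 / 2)).sub
      (tendsto_floor_div hξ.le)).congr fun n => ?_
    rw [Nat.cast_sub (hkh n), sub_div]
  have hM1 : Tendsto (fun n : ℕ => (((⌊(1 / 2 : ℝ) * n⌋₊ - ⌊ξ * n⌋₊ : ℕ) : ℝ) + 1) / n) atTop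
      (𝓝 (1 / 2 - ξ)) := by
    have := hM.add tendsto_one_div_atTop_nhds_zero_nat
    rw [add_zero] at this
    exact this.congr fun n => by rw [add_div]
  have hz := (tendsto_mul_neg_log_one_sub_div c).prodMk_nhds ((tendsto_floor_div hξ.le).prodMk_nhds
    ((tendsto_floor_div hβ.le).prodMk_nhds (hM.prodMk_nhds hM1)))
  have hbound : ∀ᶠ n : ℕ in atTop, ∑ t ∈ Finset.range ⌊a * n⌋₊, (⌊ξ * n⌋₊.choose ⌊β * n⌋₊ : ℝ) *
      reachProb (1 - c / n) ⌊β * n⌋₊ (⌊(1 / 2 : ℝ) * n⌋₊ - ⌊ξ * n⌋₊) t ≤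
      a * ((n : ℝ) ^ 1 * Real.exp (-(δ * n))) := by
    filter_upwards [hz.eventually hev, eventually_cast_lt c, eventually_cast_lt (1 / ξ),
      eventually_cast_lt (1 / β)] with n hn hcn hξn hβn
    have hn0 : (0 : ℝ) < n := hc.trans hcn
    have hk : 0 < ⌊ξ * n⌋₊ := Nat.floor_pos.2 (by
      rw [div_lt_iff₀' hξ] at hξn
      exact hξn.le)
    have hb : 0 < ⌊β * n⌋₊ := Nat.floor_pos.2 (by
      rw [div_lt_iff₀' hβ] at hβn
      exact hβn.le)
    have hl : 0 < -Real.log (1 - c / n) := by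
      have h1 := (div_lt_one hn0).2 hcn
      have h2 : 0 < c / n := by positivity
      exact neg_pos.2 (Real.log_neg (by linarith) (by linarith))
    have hT : (⌊a * n⌋₊ : ℝ) ≤ a * n := Nat.floor_le (by positivity)
    refine (Finset.sum_le_card_nsmul _ _ (Real.exp (-(δ * n))) ?_).trans ?_
    · intro t ht
      have htT : (t : ℝ) ≤ a * n :=
        le_trans (by exact_mod_cast (Finset.mem_range.1 ht).le) hT
      have h1 := choose_mul_reachProb_le hl (Nat.cast_pos.1 hn0) hk hb
        (⌊(1 / 2 : ℝ) * n⌋₊ - ⌊ξ * n⌋₊) t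
      rw [exp_neg_neg_log_one_sub_div hc hcn] at h1
      refine h1.trans (Real.exp_le_exp.2 ?_)
      have h2 := hn (t / n) ⟨by positivity, (div_le_iff₀ hn0).2 htT⟩
      have h3 := mul_le_mul_of_nonneg_left h2.le hn0.le
      linarith
    · rw [Finset.card_range, nsmul_eq_mul, pow_one, ← mul_assoc]
      exact mul_le_mul_of_nonneg_right hT (Real.exp_pos _).le
  have hlim := (tendsto_pow_mul_exp_neg_nat 1 hδ).const_mul a
  rw [mul_zero] at hlim
  refine tendsto_of_tendsto_of_tendsto_of_le_of_le' tendsto_const_nhds hlim ?_ hbound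
  filter_upwards [eventually_cast_lt c] with n hcn
  have hn0 : (0 : ℝ) < n := hc.trans hcn
  have h1 := (div_lt_one hn0).2 hcn
  have h2 : 0 < c / n := by positivity
  refine Finset.sum_nonneg fun t _ => mul_nonneg (Nat.cast_nonneg _) ?_
  rw [← sum_setReachProb]
  refine Finset.sum_nonneg fun S _ => Finset.prod_nonneg fun j _ => ?_
  split_ifs
  · exact sub_nonneg.2 (pow_le_one₀ (by linarith) (by linarith))
  · exact pow_nonneg (by linarith) _

theorem two_log_alpha {c : ℝ} (hc : 0 < c) : 2 * Real.log (alpha c) + c * alpha c = 2 := by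
  obtain ⟨h0, h1⟩ := alpha_spec hc
  have h2 := congrArg Real.log h1
  rw [Real.log_mul (by positivity) (by positivity), Real.log_div (by positivity) (by positivity),
    Real.log_exp, Real.log_exp, Real.log_pow, Real.log_one] at h2
  push_cast at h2
  linarith

/-- The exponent per unit of `T` tends to `2 log (e / (2α_c)) - c α_c`, which equals `-2 log 2` by
the equation for `α_c`. The margin comes from choosing the sets inside halves of size `n/2`. -/
theorem tendsto_choose_mul_pow {c : ℝ} (hc : 0 < c) :
    Tendsto (fun n : ℕ => (⌊(1 / 2 : ℝ) * n⌋₊.choose ⌊alpha c * n⌋₊ : ℝ) *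
      ⌊(1 / 2 : ℝ) * n⌋₊.choose ⌊alpha c * n⌋₊ *
        (1 - c / n : ℝ) ^ (⌊alpha c * n⌋₊ * ⌊alpha c * n⌋₊)) atTop (𝓝 0) := by
  obtain ⟨ha, -⟩ := alpha_spec hc
  set a := alpha c with ha_def
  have hT := tendsto_floor_div ha.le
  have hh := tendsto_floor_div (by norm_num : (0 : ℝ) ≤ 1 / 2)
  have hexp : Tendsto (fun n : ℕ => 2 * Real.log (Real.exp 1 * ((⌊(1 / 2 : ℝ) * n⌋₊ : ℝ) / n) /
      ((⌊a * n⌋₊ : ℝ) / n)) - c * ((⌊a * n⌋₊ : ℝ) / n)) atTop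
      (𝓝 (2 * Real.log (Real.exp 1 * (1 / 2) / a) - c * a)) := by
    refine Tendsto.sub (Tendsto.const_mul 2 (Tendsto.log ?_ (by positivity))) (hT.const_mul c)
    exact (hh.const_mul _).div hT ha.ne'
  have hval : 2 * Real.log (Real.exp 1 * (1 / 2) / a) - c * a < -1 := by
    rw [Real.log_div (by positivity) ha.ne', Real.log_mul (by positivity) (by positivity),
      Real.log_exp, one_div, Real.log_inv]
    have h1 := two_log_alpha hc
    have h2 := Real.log_two_gt_d9
    rw [← ha_def] at h1
    linarith
  have hTtop : Tendsto (fun n : ℕ => (⌊a * n⌋₊ : ℝ)) atTop atTop :=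
    tendsto_natCast_atTop_atTop.comp (tendsto_nat_floor_atTop.comp
      (tendsto_natCast_atTop_atTop.const_mul_atTop ha))
  have hlim : Tendsto (fun n : ℕ => Real.exp (-(⌊a * n⌋₊ : ℝ))) atTop (𝓝 0) :=
    Real.tendsto_exp_neg_atTop_nhds_zero.comp hTtop
  refine tendsto_of_tendsto_of_tendsto_of_le_of_le' tendsto_const_nhds hlim ?_ ?_
  · filter_upwards [eventually_cast_lt c] with n hcn
    have h1 := (div_lt_one (hc.trans hcn)).2 hcn
    have : (0 : ℝ) ≤ 1 - c / n := by linarith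
    positivity
  · filter_upwards [eventually_cast_lt c, hexp.eventually_lt_const hval,
      hTtop.eventually_gt_atTop 0, eventually_cast_lt 2] with n hcn hn hT0 hn2
    have hn0 : (0 : ℝ) < n := hc.trans hcn
    have h1 := (div_lt_one hn0).2 hcn
    set T := ⌊a * n⌋₊
    set h := ⌊(1 / 2 : ℝ) * n⌋₊ with hh_def
    have hhpos : 0 < h := Nat.floor_pos.2 (by linarith)
    have hTpos : 0 < T := Nat.cast_pos.1 hT0
    have h2 := choose_le_exp hhpos hTpos
    have h3 : (1 - c / n : ℝ) ≤ Real.exp (-(c / n)) := by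
      have := Real.add_one_le_exp (-(c / n : ℝ))
      linarith
    have h4 : (1 - c / n : ℝ) ^ (T * T) ≤ Real.exp ((T * T : ℕ) * (-(c / n))) := by
      rw [Real.exp_nat_mul]
      exact pow_le_pow_left₀ (by linarith) h3 _
    calc (h.choose T : ℝ) * h.choose T * (1 - c / n : ℝ) ^ (T * T)
        ≤ Real.exp (T * Real.log (Real.exp 1 * h / T)) *
            Real.exp (T * Real.log (Real.exp 1 * h / T)) *
            Real.exp ((T * T : ℕ) * (-(c / n))) := by
          have : (0 : ℝ) ≤ 1 - c / n := by linarith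
          gcongr
      _ = Real.exp (T * (2 * Real.log (Real.exp 1 * (h / n) / (T / n)) - c * (T / n))) := by
          rw [← Real.exp_add, ← Real.exp_add]
          have : Real.exp 1 * (h / n : ℝ) / (T / n) = Real.exp 1 * h / T := by field_simp
          rw [this]
          congr 1
          push_cast
          ring
      _ ≤ Real.exp (-(T : ℝ)) := by
          refine Real.exp_le_exp.2 ?_
          have := mul_le_mul_of_nonneg_left hn.le hT0.le
          linarith

/-- As `(1 - c/n)^n → e^(-c)`, the base is eventually below the constant `1 - e^(-(c+1)) < 1`, and
its power of linear order beats `n²`. -/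
theorem tendsto_sq_mul_one_sub_pow {c η : ℝ} (hc : 0 < c) (hη : 0 < η) :
    Tendsto (fun n : ℕ => (n : ℝ) ^ 2 * (1 - (1 - c / n : ℝ) ^ n) ^ (⌊η * n⌋₊ + 1)) atTop
      (𝓝 0) := by
  set s : ℝ := -Real.log (1 - Real.exp (-(c + 1))) with hs
  have hρ : Real.exp (-(c + 1)) < 1 := Real.exp_lt_one_iff.2 (by linarith)
  have hρ' := Real.exp_pos (-(c + 1))
  have hs0 : 0 < s := neg_pos.2 (Real.log_neg (by linarith) (by linarith))
  have hpow : Tendsto (fun n : ℕ => (1 - c / n : ℝ) ^ n) atTop (𝓝 (Real.exp (-c))) := by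
    have := Real.tendsto_one_add_div_pow_exp (-c)
    refine this.congr fun n => ?_
    rw [neg_div, ← sub_eq_add_neg]
  refine tendsto_of_tendsto_of_tendsto_of_le_of_le' tendsto_const_nhds
    (tendsto_pow_mul_exp_neg_nat 2 (mul_pos hs0 hη)) ?_ ?_
  · filter_upwards [eventually_cast_lt c] with n hcn
    have hn0 : (0 : ℝ) < n := hc.trans hcn
    have h1 := (div_lt_one hn0).2 hcn
    have h2 : 0 < c / n := by positivity
    have : (0 : ℝ) ≤ 1 - (1 - c / n : ℝ) ^ n :=
      sub_nonneg.2 (pow_le_one₀ (by linarith) (by linarith))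
    positivity
  · filter_upwards [eventually_cast_lt c, hpow.eventually_const_lt
      (Real.exp_lt_exp.2 (show -(c + 1) < -c by linarith))] with n hcn hn
    have hn0 : (0 : ℝ) < n := hc.trans hcn
    have h1 := (div_lt_one hn0).2 hcn
    have h2 : 0 < c / n := by positivity
    have h3 : (0 : ℝ) ≤ 1 - (1 - c / n : ℝ) ^ n :=
      sub_nonneg.2 (pow_le_one₀ (by linarith) (by linarith))
    refine mul_le_mul_of_nonneg_left ?_ (by positivity)
    calc (1 - (1 - c / n : ℝ) ^ n) ^ (⌊η * n⌋₊ + 1)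
        ≤ (1 - Real.exp (-(c + 1))) ^ (⌊η * n⌋₊ + 1) :=
          pow_le_pow_left₀ h3 (by linarith) _
      _ = Real.exp ((⌊η * n⌋₊ + 1 : ℕ) * -s) := by
          rw [Real.exp_nat_mul, hs, neg_neg, Real.exp_log (by linarith)]
      _ ≤ Real.exp (-(s * η * n)) := by
          refine Real.exp_le_exp.2 ?_
          have := Nat.lt_floor_add_one (η * n)
          push_cast
          nlinarith

theorem tendsto_binomialRandom_of_le {p : ℕ → unitInterval} {S : ∀ n, Set (SimpleGraph (Fin n))}
    {r : ℕ → ℝ} (hr : Tendsto r atTop (𝓝 0))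
    (h : ∀ᶠ n in atTop, (SimpleGraph.binomialRandom (Fin n) (p n)).real (S n)ᶜ ≤ r n) :
    Tendsto (fun n => SimpleGraph.binomialRandom (Fin n) (p n) (S n)) atTop (𝓝 1) := by
  have h1 : Tendsto (fun n => ENNReal.ofReal (1 - r n)) atTop (𝓝 1) := by
    have := ENNReal.tendsto_ofReal (hr.const_sub 1)
    simpa using this
  refine tendsto_of_tendsto_of_tendsto_of_le_of_le' h1 tendsto_const_nhds ?_
    (Eventually.of_forall fun n => prob_le_one)
  filter_upwards [h] with n hn
  rw [measureReal_compl (measurableSet_simpleGraph _), probReal_univ] at hn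
  refine ENNReal.ofReal_le_of_le_toReal ?_
  rw [← measureReal_def]
  linarith

theorem tendsto_le_posetDim {c ξ β : ℝ} (hc : 0 < c) (hξ : 0 < ξ) (hβ : 0 < β)
    (hα : ξ + alpha c < 1 / 2)
    (hf : sSup ((fun t => f c ξ β t) '' Set.Icc 0 (alpha c)) < 0) :
    Tendsto (fun n : ℕ => SimpleGraph.binomialRandom (Fin n) (edgeProb c n)
      {G | ξ / (2 * β) ≤ (posetDim (graphOrder G) : ℝ)}) atTop (𝓝 1) := by
  obtain ⟨ha, -⟩ := alpha_spec hc
  have hξ2 : ξ < 1 / 2 := by linarith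
  have hr := (((tendsto_sum_choose_mul_reachProb hc hξ hξ2 hβ ha hf).const_mul 2).add
    (tendsto_choose_mul_pow hc)).add (tendsto_sq_mul_one_sub_pow hc (show 0 < ξ / 4 by positivity))
  rw [mul_zero, add_zero, add_zero] at hr
  refine tendsto_binomialRandom_of_le hr ?_
  -- A smaller realiser would give `ξn - 1 < ξn/2 + ξn/4 + 1`, that is `n < 8/ξ`.
  filter_upwards [eventually_cast_lt c, eventually_cast_lt (8 / ξ), eventually_cast_lt (1 / β)]
    with n hcn hξn hβn
  have hn0 : (0 : ℝ) < n := hc.trans hcn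
  have hnpos : 0 < n := Nat.cast_pos.1 hn0
  have : NeZero n := ⟨hnpos.ne'⟩
  have hkh : ⌊ξ * n⌋₊ ≤ ⌊(1 / 2 : ℝ) * n⌋₊ :=
    Nat.floor_mono (mul_le_mul_of_nonneg_right hξ2.le (Nat.cast_nonneg n))
  have hhn : 2 * ⌊(1 / 2 : ℝ) * n⌋₊ ≤ n := by
    have := Nat.floor_le (show (0 : ℝ) ≤ 1 / 2 * n by positivity)
    have h2 : (2 : ℝ) * ⌊(1 / 2 : ℝ) * n⌋₊ ≤ n := by linarith
    exact_mod_cast h2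
  have hb : 0 < ⌊β * n⌋₊ := Nat.floor_pos.2 (by
    rw [div_lt_iff₀' hβ] at hβn
    exact hβn.le)
  have hpe := edgeProb_eq hc hcn
  have h1 := binomialRandom_exists_isRealiser_le (T := ⌊alpha c * n⌋₊) hkh hhn hb
    (Nat.succ_pos ⌊ξ / 4 * n⌋₊) (edgeProb c n) (by rw [hpe]; positivity)
    (by rw [hpe]; exact (div_lt_one hn0).2 hcn)
  rw [hpe] at h1
  refine le_trans (measureReal_mono ?_ (measure_ne_top _ _)) h1
  intro G hG
  simp only [Set.mem_compl_iff, Set.mem_ofPred_eq] at hG ⊢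
  by_contra! hcon
  refine hG (le_posetDim _ fun R hR => ?_)
  by_contra! hlt
  have h2 : (⌊ξ * n⌋₊ : ℝ) < R.ncard * ⌊β * n⌋₊ + (⌊ξ / 4 * n⌋₊ + 1) := by
    exact_mod_cast hcon R hR
  have h3 := Nat.lt_floor_add_one (ξ * n)
  have h4 := Nat.floor_le (show 0 ≤ β * n by positivity)
  have h5 := Nat.floor_le (show 0 ≤ ξ / 4 * n by positivity)
  have h6 : (R.ncard : ℝ) * ⌊β * n⌋₊ ≤ ξ / 2 * n := by
    calc (R.ncard : ℝ) * ⌊β * n⌋₊ ≤ ξ / (2 * β) * (β * n) := by gcongr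
      _ = ξ / 2 * n := by field_simp
  rw [div_lt_iff₀' hξ] at hξn
  linarith

/-! ### Part (b): explicit parameters for large `c`, dimension 2 otherwise. -/

theorem log_le_mul_log_two {x : ℝ} (hx : 0 < x) {j : ℕ} (h : x ≤ 2 ^ j) :
    Real.log x ≤ j * 0.7 := by
  have h1 := Real.log_le_log hx h
  rw [Real.log_pow] at h1
  have h2 := Real.log_two_lt_d9
  have h3 : (j : ℝ) * Real.log 2 ≤ j * 0.7 := by gcongr; linarith
  linarith

theorem alpha_le {c : ℝ} (hc : 1000 ≤ c) : alpha c ≤ 1 / 48 := by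
  have hc0 : 0 < c := by linarith
  obtain ⟨ha, -⟩ := alpha_spec hc0
  by_contra! hcon
  have h1 := two_log_alpha hc0
  have h2 := Real.log_lt_log (by norm_num) hcon
  rw [one_div, Real.log_inv] at h2
  have h3 := log_le_mul_log_two (show (0 : ℝ) < 48 by norm_num) (j := 6) (by norm_num)
  push_cast at h3
  nlinarith

/-- In units of `cβ`, the binomial term and `Li₂(1) - Li₂(e^(-cβ))` contribute at most `1/6` each up
to lower order, while the linear term gives at most `-(1/2 - 1/12 - 1/48) = -19/48`. The surplus
`1/16` absorbs the constants once `c ≥ 1000`. The other dilogarithm differences are dropped by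
monotonicity. -/
theorem f_le_of_large {c β t : ℝ} (hc : 1000 ≤ c) (hβ : β = 1 / 24 * Real.exp (-(c / 6)))
    (ht : t ∈ Set.Icc 0 (alpha c)) : f c (1 / 12) β t ≤ -β := by
  have hc0 : 0 < c := by linarith
  have hβ0 : 0 < β := by rw [hβ]; positivity
  have htα := ht.2.trans (alpha_le hc)
  have ht0 := ht.1
  have hlogβ : Real.log β = -Real.log 24 - c / 6 := by
    rw [hβ, Real.log_mul (by norm_num) (Real.exp_pos _).ne', Real.log_exp, one_div, Real.log_inv]
    ring
  have hlog1 : Real.log (Real.exp 1 * (1 / 12) / β) = 1 + Real.log 2 + c / 6 := by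
    rw [Real.log_div (by positivity) hβ0.ne', Real.log_mul (by positivity) (by norm_num),
      Real.log_exp, hlogβ, one_div, Real.log_inv,
      show (24 : ℝ) = 2 * 12 by norm_num, Real.log_mul (by norm_num) (by norm_num)]
    ring
  have hcβ : c * β ≤ 1 := by
    have h1 : c / 6 ≤ Real.exp (c / 6) := by linarith [Real.add_one_le_exp (c / 6)]
    have h2 : c / 6 * Real.exp (-(c / 6)) ≤ 1 := by
      rw [Real.exp_neg, ← div_eq_mul_inv]
      exact (div_le_one (Real.exp_pos _)).2 h1
    rw [hβ]
    linarith
  have hlogc : 0 ≤ Real.log c := Real.log_nonneg (by linarith)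
  have hLi := Li2_one_sub_le (mul_pos hc0 hβ0) hcβ
  rw [Real.log_mul hc0.ne' hβ0.ne', hlogβ] at hLi
  have hct : 0 ≤ c * t := by positivity
  have hm1 : Li2 (Real.exp (-(c * β) - c * t)) ≤ Li2 (Real.exp (-(c * t))) := by
    refine Li2_mono (Real.exp_pos _).le (Real.exp_le_exp.2 ?_) (by simpa using hct)
    have := mul_pos hc0 hβ0
    linarith
  have hm2 : Li2 (Real.exp (-(c * (1 / 2 - 1 / 12 - t)) - c * t)) ≤
      Li2 (Real.exp (-(c * (1 / 2 - 1 / 12 - t)))) := by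
    refine Li2_mono (Real.exp_pos _).le (Real.exp_le_exp.2 (by linarith)) ?_
    have : 0 ≤ c * (1 / 2 - 1 / 12 - t) := mul_nonneg hc0.le (by linarith)
    simpa using this
  have hsum : 1 / c * (Li2 1 - Li2 (Real.exp (-(c * t)))) +
      1 / c * (Li2 (Real.exp (-(c * β) - c * t)) - Li2 (Real.exp (-(c * β)))
        + Li2 (Real.exp (-(c * (1 / 2 - 1 / 12 - t)) - c * t))
        - Li2 (Real.exp (-(c * (1 / 2 - 1 / 12 - t))))) ≤
      β * (Real.log 2 + 1 + Real.log 24 + c / 6) := by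
    rw [← mul_add, one_div_mul_eq_div, div_le_iff₀ hc0]
    have h3 : c * β * (Real.log 2 + 1 - (Real.log c + (-Real.log 24 - c / 6))) ≤
        c * β * (Real.log 2 + 1 + Real.log 24 + c / 6) := by
      refine mul_le_mul_of_nonneg_left (by linarith) (mul_pos hc0 hβ0).le
    linarith
  have h24 := log_le_mul_log_two (show (0 : ℝ) < 24 by norm_num) (j := 5) (by norm_num)
  have h2 := log_le_mul_log_two (show (0 : ℝ) < 2 by norm_num) (j := 1) (by norm_num)
  push_cast at h24 h2
  have hlin : c * β * (1 / 2 - 1 / 12 - t) ≥ c * β * (19 / 48) :=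
    mul_le_mul_of_nonneg_left (by linarith) (mul_pos hc0 hβ0).le
  have hfin : β * (1 + Real.log 2 + c / 6) + β * (Real.log 2 + 1 + Real.log 24 + c / 6) -
      c * β * (19 / 48) ≤ -β := by
    have : β * (2 + 2 * Real.log 2 + Real.log 24 - c / 16) ≤ β * (-1) :=
      mul_le_mul_of_nonneg_left (by linarith) hβ0.le
    linarith
  rw [f, hlog1]
  linarith

theorem tendsto_exp_le_posetDim_of_large {c : ℝ} (hc : 1000 ≤ c) :
    Tendsto (fun n : ℕ => SimpleGraph.binomialRandom (Fin n) (edgeProb c n)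
      {G | Real.exp (1 / 6 * c) ≤ (posetDim (graphOrder G) : ℝ)}) atTop (𝓝 1) := by
  have hc0 : 0 < c := by linarith
  obtain ⟨ha, -⟩ := alpha_spec hc0
  have hα := alpha_le hc
  have hβ0 : 0 < 1 / 24 * Real.exp (-(c / 6)) := by positivity
  have h := tendsto_le_posetDim (ξ := 1 / 12) hc0 (by norm_num) hβ0 (by linarith) (by
    refine lt_of_le_of_lt (csSup_le ((Set.nonempty_Icc.2 ha.le).image _) ?_) (neg_lt_zero.2 hβ0)
    rintro _ ⟨t, ht, rfl⟩
    exact f_le_of_large hc rfl ht)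
  have he : 1 / 12 / (2 * (1 / 24 * Real.exp (-(c / 6)))) = Real.exp (1 / 6 * c) := by
    rw [Real.exp_neg, show 1 / 6 * c = c / 6 by ring]
    have := Real.exp_pos (c / 6)
    field_simp
    norm_num
  rwa [he] at h

/-- An increasing path from `0` to `1` has no room for an intermediate vertex, so without the edge
the two are incomparable. -/
theorem two_le_posetDim_graphOrder {n : ℕ} (G : SimpleGraph (Fin (n + 2)))
    (hG : ¬ G.Adj 0 1) : (2 : ℝ) ≤ posetDim (graphOrder G) := by
  refine two_le_posetDim (graphOrder G) (i := 0) (j := 1) ?_ ?_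
  · intro h
    have key : ∀ v, (graphOrder G).le 0 v → v = 0 ∨ 2 ≤ v.val := by
      intro v hv
      induction hv with
      | refl => exact Or.inl rfl
      | @tail u v hu huv ih =>
        right
        have hlt : u.val < v.val := huv.1
        rcases ih with rfl | h2
        · have hne : v.val ≠ 1 := by
            intro h1
            have : v = 1 := Fin.ext (by simpa using h1)
            exact hG (this ▸ huv.2)
          have : (0 : Fin (n + 2)).val = 0 := rfl
          omega
        · omega
    rcases key 1 h with h1 | h1
    · simp at h1
    · simp at h1
  · intro h
    have := le_of_graphOrder_le h
    simp at this

theorem tendsto_two_le_posetDim {c : ℝ} (hc : 0 < c) :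
    Tendsto (fun n : ℕ => SimpleGraph.binomialRandom (Fin n) (edgeProb c n)
      {G | (2 : ℝ) ≤ (posetDim (graphOrder G) : ℝ)}) atTop (𝓝 1) := by
  refine tendsto_binomialRandom_of_le (tendsto_const_div_atTop_nhds_zero_nat c) ?_
  filter_upwards [eventually_cast_lt c, eventually_ge_atTop 2] with n hcn hn2
  obtain ⟨n, rfl⟩ := Nat.exists_eq_add_of_le' hn2
  have h1 := binomialRandom_forall_notMem (V := Fin (n + 2)) (edgeProb c (n + 2)) {s(0, 1)} (by simp)
  rw [edgeProb_eq hc hcn, Finset.card_singleton, pow_one] at h1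
  have h2 : {G : SimpleGraph (Fin (n + 2)) | (2 : ℝ) ≤ (posetDim (graphOrder G) : ℝ)}ᶜ ⊆
      {G | ∀ e ∈ ({s(0, 1)} : Finset (Sym2 (Fin (n + 2)))), e ∉ G.edgeSet}ᶜ := by
    rw [Set.compl_subset_compl]
    intro G hG
    exact two_le_posetDim_graphOrder G (by simpa using hG)
  refine (measureReal_mono h2 (measure_ne_top _ _)).trans_eq ?_
  rw [measureReal_compl (measurableSet_simpleGraph _), probReal_univ, h1]
  ring

end RandomGraphOrder

theorem theorem2p6 :
    (∀ c ξ β : ℝ, 0 < c → 0 < ξ → 0 < β →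
      ξ + RandomGraphOrder.alpha c < 1 / 2 →
      sSup ((fun t => RandomGraphOrder.f c ξ β t) '' Set.Icc 0 (RandomGraphOrder.alpha c)) < 0 →
      Tendsto (fun n : ℕ => SimpleGraph.binomialRandom (Fin n) (RandomGraphOrder.edgeProb c n)
          {G | ξ / (2 * β) ≤ (RandomGraphOrder.posetDim (RandomGraphOrder.graphOrder G) : ℝ)})
        atTop (𝓝 1)) ∧
    (∃ γ : ℝ → ℝ, (∀ c : ℝ, 0 < c → 0 < γ c) ∧ Tendsto γ atTop (𝓝 (1 / 6)) ∧
      ∀ c : ℝ, 0 < c →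
        Tendsto (fun n : ℕ => SimpleGraph.binomialRandom (Fin n) (RandomGraphOrder.edgeProb c n)
            {G | Real.exp (γ c * c) ≤
              (RandomGraphOrder.posetDim (RandomGraphOrder.graphOrder G) : ℝ)})
          atTop (𝓝 1)) := by
  classical
  refine ⟨fun c ξ β hc hξ hβ hα hf => RandomGraphOrder.tendsto_le_posetDim hc hξ hβ hα hf,
    -- In the second case `e^(γ(c) c) = 2`.
    fun c => if 1000 ≤ c then 1 / 6 else Real.log 2 / c, ?_, ?_, ?_⟩
  · intro c hc
    dsimp only
    split_ifs
    · norm_num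
    · exact div_pos (Real.log_pos one_lt_two) hc
  · refine tendsto_const_nhds.congr' ?_
    filter_upwards [eventually_ge_atTop 1000] with c hc
    rw [if_pos hc]
  · intro c hc
    dsimp only
    split_ifs with h
    · exact RandomGraphOrder.tendsto_exp_le_posetDim_of_large h
    · have he : Real.exp (Real.log 2 / c * c) = 2 := by
        rw [div_mul_cancel₀ _ hc.ne', Real.exp_log two_pos]
      rw [he]
      exact RandomGraphOrder.tendsto_two_le_posetDim hc
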